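/- Let $d\ge 1$, $f\ge 0$ and $n>(d+2)f$ be integers and let $\varepsilon>0$. Consider $n$ agents with inputs $x_i\in\mathbb{R}^d$ (Euclidean norm) that communicate by asynchronous message passing over reliable authenticated channels (every message between correct agents is eventually received; delays are unbounded); an unknown set of at most $f$ agents is Byzantine and can send arbitrary messages. Let $\Delta$ be the diameter of the set of inputs of the correct agents, which is not known to the agents. For a multiset $V$ of vectors, each tagged with the agent it is attributed to, the safe area $S(V)$ is the intersection of the convex hulls of all sub-multisets of $V$ of size $|V|-f$. Consider the following algorithm, built on Bracha's reliable broadcast. In every round $t=0,1,2,\dots$ each agent $i$ reliably broadcasts its current vector $y_i(t)$, where $y_i(0)=x_i$; after delivering vectors of round $t$ from at least $n-f$ agents it reliably broadcasts a report, the set of these agents; agent $j$ is a witness for $i$ when $i$ has delivered a report of $j$ that lists at least $n-f$ agents, together with the vectors of all of the agents listed; when $i$ has at least $n-f$ witnesses it finishes the round. For a nonempty compact set $S$ let $m(S)$ be the midpoint of two points of $S$ that realize the Euclidean diameter of $S$, chosen by a fixed rule common to all agents. * Initial round $t=0$ (estimation): for each of its witnesses $j$, agent $i$ computes $u_j=m(S(X_j))$,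 where $X_j$ is the multiset of the vectors of round $0$ listed in the report of $j$. With $U_i$ the multiset of these $u_j$, it sets $y_i(1)=m(S(U_i))$ and $e_i=\operatorname{diam}(U_i)$. * Rounds $t\ge 1$: with $V_i(t)$ the multiset of all vectors of round $t$ that it has delivered, agent $i$ sets $y_i(t+1)=m(S(V_i(t)))$. * Agent $i$ decides $y_i(1+R_i)$, where $R_i=\lceil\log_{\sqrt{8/7}}(e_i/\varepsilon)\rceil$ if $e_i>\varepsilon$ and $R_i=0$ otherwise. It continues to take part in all rounds. Then this algorithm solves approximate consensus: in every execution each correct agent decides, irrevocably; any two decisions of correct agents have distance at most $\varepsilon$; and decisions of correct agents lie in the convex hull of the inputs of the correct agents. Moreover, in every execution the correct agents reach all rounds, and with $\delta(t)=\max_{i,j\text{ correct}}\lVert y_i(t)-y_j(t)\rVert$ and $T=\lceil\log_{\sqrt{8/7}}(\Delta/\varepsilon)\rceil$ if $\Delta>\varepsilon$, $T=0$ otherwise: 1. for all $t\ge1$ and all correct $i,j$: vectors in $V_i(t)$ attributed to a correct agent $o$ equal $y_o(t)$, $|V_i(t)\cap V_j(t)|\ge n-f$, $S(V_i(t))$ is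 contained in the convex hull of $\{y_o(t) : o \text{ correct}\}$, $S(V_i(t))\cap S(V_j(t))\ne\emptyset$, and $y_i(t+1)$ is the midpoint of two points of $S(V_i(t))$ that realize its diameter; 2. $\delta(1)\le\delta(0)=\Delta$, and $\delta(t+1)\le\sqrt{7/8}\;\delta(t)$ for all $t\ge 1$; 3. $\delta(t)\le\varepsilon$ for all $t\ge 1+T$, and every correct agent $i$ decides $y_i(r)$ for some $r$ with $1\le r\le 1+T$; that is, the round complexity is $O(\log(\Delta/\varepsilon))$, independently of $d$, $n$ and $f$. In contrast, consider the coordinate-wise (Mendes–Herlihy) algorithm with the same round structure, in which, for a given bound $D\ge\Delta$ on the initial diameter, the coordinates $k=1,\dots,d$ are treated one after the other for $\lceil\log_2(\sqrt d D/\varepsilon)\rceil$ rounds each (after the initial round), the new vector being a point of the safe area whose $k$-th coordinate is the midpoint of the set of $k$-th coordinates of the safe area, and agents decide after the last of these rounds. If $\Delta\ge\varepsilon$, then in every execution each correct agent decides, and not before it has reached round $\frac12\, d\log_2(d\Delta/\varepsilon)$; so the round complexity is $\Omega(d\log(d\Delta/\varepsilon))$. -/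

import Mathlib

noncomputable section

open scoped Classical

namespace ByzMP

/-! ### Asynchronous message passing with Byzantine agents -/

/-- A deterministic message-passing protocol for `n` agents.  Communication is by broadcast: a
message that enters the `outbox` is sent to every agent, including the sender.  `recv st s m` is the
state after receiving `m` from `s` (channels are authenticated: the receiver knows the sender). -/
structure Protocol (n : ℕ) (In Msg St Out : Type) where
  init : In → St
  recv : St → Fin n → Msg → St
  /-- all messages broadcast so far -/
  outbox : St → Set Msg
  outbox_mono : ∀ st s m, outbox st ⊆ outbox (recv st s m)
  /-- the write-once decision variable; `none` stands for `⊥` -/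
  decision : St → Option Out

/-- A schedule says which message is received at each step: `some (s, r, m)` means that `r`
receives `m` from `s`; `none` is an idle step. -/
abbrev Schedule (n : ℕ) (Msg : Type) := ℕ → Option (Fin n × Fin n × Msg)

/-- The local states after the first `k` steps. -/
def Protocol.state {n : ℕ} {In Msg St Out : Type} (P : Protocol n In Msg St Out)
    (x : Fin n → In) (ev : Schedule n Msg) : ℕ → Fin n → St
  | 0 => fun i => P.init (x i)
  | k + 1 =>
    match ev k with
    | none => P.state x ev k
    | some (s, r, m) => Function.update (P.state x ev k) r (P.recv (P.state x ev k r) s m)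

/-- Admissible asynchronous executions with set `B` of Byzantine agents.  A message received from a
correct agent was sent by it before, and a message between correct agents is eventually received;
delays are unbounded, messages can be reordered and even duplicated.  A Byzantine agent can send
any message to any agent at any time. -/
structure Protocol.IsExecution {n : ℕ} {In Msg St Out : Type} (P : Protocol n In Msg St Out)
    (B : Finset (Fin n)) (x : Fin n → In) (ev : Schedule n Msg) : Prop where
  integrity : ∀ k s r m, ev k = some (s, r, m) → s ∉ B → m ∈ P.outbox (P.state x ev k s)
  reliability : ∀ k s r m, s ∉ B → r ∉ B → m ∈ P.outbox (P.state x ev k s) →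
    ∃ k', ev k' = some (s, r, m)

/-- `P` solves approximate consensus with tolerance `ε` in the presence of up to `f` Byzantine
agents. -/
def Protocol.SolvesApproxConsensus {n : ℕ} {E Msg St : Type} [NormedAddCommGroup E]
    [NormedSpace ℝ E] (P : Protocol n E Msg St E) (f : ℕ) (ε : ℝ) : Prop :=
  ∀ B : Finset (Fin n), B.card ≤ f → ∀ (x : Fin n → E) (ev : Schedule n Msg),
    P.IsExecution B x ev →
      -- each correct agent decides
      (∀ i ∉ B, ∃ k v, P.decision (P.state x ev k i) = some v) ∧
      -- decisions are irrevocable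
      (∀ i ∉ B, ∀ k l v, k ≤ l → P.decision (P.state x ev k i) = some v →
        P.decision (P.state x ev l i) = some v) ∧
      -- ε-agreement
      (∀ i ∉ B, ∀ j ∉ B, ∀ k l v w, P.decision (P.state x ev k i) = some v →
        P.decision (P.state x ev l j) = some w → ‖v - w‖ ≤ ε) ∧
      -- validity: decisions lie in the convex hull of the inputs of the correct agents
      (∀ i ∉ B, ∀ k v, P.decision (P.state x ev k i) = some v →
        v ∈ convexHull ℝ (x '' {j | j ∉ B}))

/-! ### Safe areas -/

abbrev Vec (d : ℕ) := EuclideanSpace ℝ (Fin d)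

/-- A multiset of vectors, at most one from each agent, tagged with the agent. -/
abbrev Coll (n d : ℕ) := Fin n → Option (Vec d)

def Coll.dom {n d : ℕ} (V : Coll n d) : Finset (Fin n) :=
  Finset.univ.filter fun o => (V o).isSome

/-- The vectors that the agents in `T` contributed to `V`. -/
def Coll.vals {n d : ℕ} (V : Coll n d) (T : Finset (Fin n)) : Set (Vec d) :=
  {v | ∃ o ∈ T, V o = some v}

def Coll.restrict {n d : ℕ} (V : Coll n d) (A : Finset (Fin n)) : Coll n d :=
  fun o => if o ∈ A then V o else none

/-- The agents that contributed the same vector to `V` and to `W`, i.e. the intersection of the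
two tagged multisets. -/
def Coll.common {n d : ℕ} (V W : Coll n d) : Finset (Fin n) :=
  Finset.univ.filter fun o => ∃ v, V o = some v ∧ W o = some v

/-- The intersection of the convex hulls of all sub-multisets of `V` of size `|V| - f`. -/
def safeArea {n d : ℕ} (f : ℕ) (V : Coll n d) : Set (Vec d) :=
  {p | ∀ T ⊆ V.dom, T.card = V.dom.card - f → p ∈ convexHull ℝ (V.vals T)}

/-! ### The round structure: reliable broadcast and the witness technique -/

/-- What is reliably broadcast in round `t`: the vector of an agent, and its report, the set of
agents whose round-`t` vectors it had delivered. -/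
inductive Item (n d : ℕ) : Type
  | value (t : ℕ) (v : Vec d)
  | report (t : ℕ) (A : Finset (Fin n))

/-- Each agent has one reliable broadcast for each key. -/
def Item.key {n d : ℕ} : Item n d → ℕ × Bool
  | .value t _ => (t, false)
  | .report t _ => (t, true)

/-- Messages of Bracha's reliable broadcast; `o` is the agent whose broadcast is relayed. -/
inductive Msg (n d : ℕ) : Type
  | init (it : Item n d)
  | echo (o : Fin n) (it : Item n d)
  | ready (o : Fin n) (it : Item n d)

/-- The parameters of the round structure that distinguish the algorithms: `point t S` is the new
vector computed in round `t` from the safe area `S`, and `rounds e` is the number of rounds after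
the initial one until the decision, where `e` is the diameter estimated in the initial round. -/
structure Rule (d : ℕ) where
  point : ℕ → Set (Vec d) → Vec d
  rounds : ℝ → ℕ

structure LocalState (n d : ℕ) where
  /-- messages received, with their senders -/
  rcv : Set (Fin n × Msg n d)
  /-- messages broadcast -/
  sent : Set (Msg n d)
  /-- current round -/
  round : ℕ
  /-- `val t` is the agent's vector at the beginning of round `t`, for `t ≤ round` -/
  val : ℕ → Vec d
  /-- `coll t` is the multiset whose safe area was used in round `t`, for `t < round` -/
  coll : ℕ → Coll n d
  /-- the estimated diameter, for `1 ≤ round` -/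
  est : ℝ

namespace LocalState

variable {n d : ℕ}

def echoes (st : LocalState n d) (o : Fin n) (it : Item n d) : ℕ :=
  (Finset.univ.filter fun j : Fin n => (j, Msg.echo o it) ∈ st.rcv).card

def readies (st : LocalState n d) (o : Fin n) (it : Item n d) : ℕ :=
  (Finset.univ.filter fun j : Fin n => (j, Msg.ready o it) ∈ st.rcv).card

/-- `it` has been delivered by the reliable broadcast of `o`. -/
def Delivered (f : ℕ) (st : LocalState n d) (o : Fin n) (it : Item n d) : Prop :=
  2 * f + 1 ≤ st.readies o it

/-- The vectors of round `t` delivered so far. -/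
def values (f : ℕ) (st : LocalState n d) (t : ℕ) : Coll n d := fun o =>
  if h : ∃ v, st.Delivered f o (.value t v) then some h.choose else none

/-- The report of `j` for round `t`, provided that it is valid: it lists at least `n - f` agents, and
the vectors of all of them have been delivered. -/
def reportOf (f : ℕ) (st : LocalState n d) (t : ℕ) (j : Fin n) : Option (Finset (Fin n)) :=
  if h : ∃ A : Finset (Fin n), st.Delivered f j (.report t A) ∧ n - f ≤ A.card ∧
      A ⊆ (st.values f t).dom
  then some h.choose else none

/-- The witnesses for round `t`: the agents with a valid report. -/
def witnesses (f : ℕ) (st : LocalState n d) (t : ℕ) : Finset (Fin n) :=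
  Finset.univ.filter fun j => (st.reportOf f t j).isSome

/-- Bracha's reliable broadcast: reaction to the reception of `m` from `s`, where `m` is already
recorded in `rcv`. -/
def relay (f : ℕ) (st : LocalState n d) (s : Fin n) : Msg n d → LocalState n d
  | .init it =>
    if ∀ it' : Item n d, it'.key = it.key → Msg.echo s it' ∉ st.sent
    then { st with sent := insert (Msg.echo s it) st.sent } else st
  | .echo o it =>
    if n - f ≤ st.echoes o it ∧
      ∀ it' : Item n d, it'.key = it.key → Msg.ready o it' ∉ st.sent
    then { st with sent := insert (Msg.ready o it) st.sent } else st
  | .ready o it =>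
    if f + 1 ≤ st.readies o it ∧
      ∀ it' : Item n d, it'.key = it.key → Msg.ready o it' ∉ st.sent
    then { st with sent := insert (Msg.ready o it) st.sent } else st

/-- The multiset used in the current round.  In rounds `t ≥ 1` these are all vectors of the round
delivered so far.  In the initial round `0` each witness contributes the point that the rule selects
in the safe area of the vectors listed in its report; these points, unlike the delivered vectors,
lie in the convex hull of the inputs of the correct agents even for Byzantine witnesses. -/
def current (f : ℕ) (R : Rule d) (st : LocalState n d) : Coll n d :=
  if st.round = 0 then fun j => (st.reportOf f 0 j).map fun A =>
      R.point 0 (safeArea f ((st.values f 0).restrict A))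
  else st.values f st.round

/-- Go to the next round: update the vector inside the safe area and broadcast it.  The initial
round also yields the estimate of the diameter. -/
def advance (f : ℕ) (R : Rule d) (st : LocalState n d) : LocalState n d :=
  let V := st.current f R
  let y := R.point st.round (safeArea f V)
  { st with
    sent := insert (Msg.init (.value (st.round + 1) y)) st.sent
    round := st.round + 1
    val := Function.update st.val (st.round + 1) y
    coll := Function.update st.coll st.round V
    est := if st.round = 0 then Metric.diam (V.vals V.dom) else st.est }

/-- The agent has broadcast its report for the current round. -/
def Reported (st : LocalState n d) : Prop :=
  ∃ A, Msg.init (.report st.round A) ∈ st.sent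

/-- After `n - f` vectors of the current round have been delivered, broadcast a report; after that,
when there are `n - f` witnesses, go to the next round. -/
def progress (f : ℕ) (R : Rule d) (st : LocalState n d) : LocalState n d :=
  if st.Reported then
    if n - f ≤ (st.witnesses f st.round).card then st.advance f R else st
  else if n - f ≤ (st.values f st.round).dom.card then
    { st with sent :=
        insert (Msg.init (.report st.round (st.values f st.round).dom)) st.sent }
  else st

def receive (f : ℕ) (R : Rule d) (st : LocalState n d) (s : Fin n) (m : Msg n d) :
    LocalState n d :=
  (relay f { st with rcv := insert (s, m) st.rcv } s m).progress f R

theorem subset_relay (f : ℕ) (st : LocalState n d) (s : Fin n) (m : Msg n d) :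
    st.sent ⊆ (st.relay f s m).sent := by
  cases m <;> simp only [relay] <;> split_ifs <;>
    first | exact Set.subset_insert _ _ | exact subset_rfl

theorem subset_progress (f : ℕ) (R : Rule d) (st : LocalState n d) :
    st.sent ⊆ (st.progress f R).sent := by
  unfold progress advance
  split_ifs <;> first | exact Set.subset_insert _ _ | exact subset_rfl

end LocalState

/-- The round structure: an agent starts in the initial round `0` with its input, runs forever, and
decides the vector it has after the initial round and `R.rounds e` further rounds, where `e` is its
estimate of the diameter. -/
def roundProtocol (n d f : ℕ) (R : Rule d) :
    Protocol n (Vec d) (Msg n d) (LocalState n d) (Vec d) where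
  init x :=
    { rcv := ∅, sent := {Msg.init (.value 0 x)}, round := 0, val := fun _ => x,
      coll := fun _ _ => none, est := 0 }
  recv st s m := st.receive f R s m
  outbox st := st.sent
  outbox_mono st s m :=
    (LocalState.subset_relay f { st with rcv := insert (s, m) st.rcv } s m).trans
      (LocalState.subset_progress f R _)
  decision st :=
    if 1 + R.rounds st.est ≤ st.round then some (st.val (1 + R.rounds st.est)) else none

/-! ### The two algorithms -/

/-- `sel` selects two points that realize the diameter. -/
def IsDiamSelector {d : ℕ} (sel : Set (Vec d) → Vec d × Vec d) : Prop :=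
  ∀ S, IsCompact S → S.Nonempty →
    (sel S).1 ∈ S ∧ (sel S).2 ∈ S ∧ dist (sel S).1 (sel S).2 = Metric.diam S

/-- Number of rounds after which a diameter of at most `D` has shrunk to at most `ε`, at the rate
`√(7/8)` per round. -/
def midRounds (ε D : ℝ) : ℕ := ⌈Real.logb (Real.sqrt (8 / 7)) (D / ε)⌉₊

/-- The new vector is the midpoint of two points that realize the diameter of the safe area. -/
def midExtremes {d : ℕ} (sel : Set (Vec d) → Vec d × Vec d) (ε : ℝ) : Rule d where
  point _ S := midpoint ℝ (sel S).1 (sel S).2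
  rounds e := midRounds ε e

/-- `c k` selects a point whose `k`-th coordinate is the midpoint of the set of `k`-th coordinates. -/
def IsCoordSelector {d : ℕ} (c : ℕ → Set (Vec d) → Vec d) : Prop :=
  ∀ (k : Fin d) (S : Set (Vec d)), IsCompact S → Convex ℝ S → S.Nonempty →
    c k S ∈ S ∧ c k S k = (sInf ((fun p : Vec d => p k) '' S) + sSup ((fun p : Vec d => p k) '' S)) / 2

/-- Number of rounds per coordinate in the coordinate-wise algorithm: after halving that often, a
diameter of at most `D` has shrunk to at most `ε / √d`. -/
def coordRounds (d : ℕ) (ε D : ℝ) : ℕ := ⌈Real.logb 2 (Real.sqrt d * D / ε)⌉₊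

/-- The coordinate-wise Mendes–Herlihy algorithm for a bound `D` on the diameter: the coordinates
are treated one after the other, for `coordRounds d ε D` rounds each. -/
def mendesHerlihy {d : ℕ} (c : ℕ → Set (Vec d) → Vec d) (ε D : ℝ) : Rule d where
  point t S := c ((t - 1) / coordRounds d ε D % d) S
  rounds _ := d * coordRounds d ε D

/-- The diameter of the vectors of the correct agents. -/
def correctDiam {n d : ℕ} (B : Finset (Fin n)) (y : Fin n → Vec d) : ℝ :=
  Metric.diam (y '' {i | i ∉ B})

end ByzMP

end

open ByzMP

/-!
Two facts drive the contraction. Any two correct agents share a witness, hence `n - f` tagged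
vectors, and by Helly's theorem the safe area of these common vectors is nonempty, so that the
safe areas of the two agents meet in a point `c`. If `a b` and `a' b'` realize the diameters of the
two safe areas, then `c` is at most `√3/2` times the respective diameter away from each midpoint, so
the midpoints are close when both diameters are small. When the diameters are large, the identity
`4 |m m'|² + |a b|² + |a' b'|² = |a a'|² + |a b'|² + |b a'|² + |b b'|²` makes the midpoints close,
because the right-hand side is at most `4 δ²`.

Reliable broadcast makes the points `u_j` of the initial round common to all agents. Each `y_i(1)`
therefore lies in the convex hull of the part of `U_i` that is also in any other `U_j`, which shows
`δ(1) ≤ e_j`: an agent that trusts its own estimate never stops too early.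
-/

noncomputable section

namespace ByzMP

/-! ### Midpoints of diameters -/

/-- The points `a` and `b` of `S` realize the diameter of `S`. -/
def RealizesDiam {P : Type*} [PseudoMetricSpace P] (S : Set P) (a b : P) : Prop :=
  a ∈ S ∧ b ∈ S ∧ dist a b = Metric.diam S

section Midpoints

variable {E P : Type*} [NormedAddCommGroup E] [InnerProductSpace ℝ E] [MetricSpace P]
  [NormedAddTorsor E P] {a b a' b' c : P} {δ : ℝ}

theorem dist_midpoint_sq_le (ha : dist c a ≤ dist a b) (hb : dist c b ≤ dist a b) :
    dist c (midpoint ℝ a b) ^ 2 ≤ 3 / 4 * dist a b ^ 2 := by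
  have median := EuclideanGeometry.dist_sq_add_dist_sq_eq_two_mul_dist_midpoint_sq_add_half_dist_sq
    c a b
  have ha2 : dist c a ^ 2 ≤ dist a b ^ 2 := by gcongr
  have hb2 : dist c b ^ 2 ≤ dist a b ^ 2 := by gcongr
  linarith

theorem four_mul_dist_midpoint_midpoint_sq_add (a b a' b' : P) :
    4 * dist (midpoint ℝ a b) (midpoint ℝ a' b') ^ 2 + dist a b ^ 2 + dist a' b' ^ 2 =
      dist a a' ^ 2 + dist a b' ^ 2 + dist b a' ^ 2 + dist b b' ^ 2 := by
  have median :=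
    EuclideanGeometry.dist_sq_add_dist_sq_eq_two_mul_dist_midpoint_sq_add_half_dist_sq (P := P)
  have median_a := median a a' b'
  have median_b := median b a' b'
  have median_ab := median (midpoint ℝ a' b') a b
  simp only [dist_comm (midpoint ℝ a' b')] at median_ab
  linarith

theorem dist_midpoint_midpoint_sq_le (ha : dist c a ≤ dist a b) (hb : dist c b ≤ dist a b)
    (ha' : dist c a' ≤ dist a' b') (hb' : dist c b' ≤ dist a' b')
    (haa' : dist a a' ≤ δ) (hab' : dist a b' ≤ δ) (hba' : dist b a' ≤ δ) (hbb' : dist b b' ≤ δ) :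
    dist (midpoint ℝ a b) (midpoint ℝ a' b') ^ 2 ≤ 6 / 7 * δ ^ 2 := by
  set m := midpoint ℝ a b
  set m' := midpoint ℝ a' b'
  have small : dist m m' ^ 2 ≤ 3 / 2 * (dist a b ^ 2 + dist a' b' ^ 2) :=
    calc dist m m' ^ 2 ≤ (dist c m + dist c m') ^ 2 := by gcongr; exact dist_triangle_left m m' c
      _ ≤ 2 * (dist c m ^ 2 + dist c m' ^ 2) := add_sq_le
      _ ≤ 2 * (3 / 4 * dist a b ^ 2 + 3 / 4 * dist a' b' ^ 2) := by
        gcongr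
        exacts [dist_midpoint_sq_le ha hb, dist_midpoint_sq_le ha' hb']
      _ = 3 / 2 * (dist a b ^ 2 + dist a' b' ^ 2) := by ring
  have large : 4 * dist m m' ^ 2 + dist a b ^ 2 + dist a' b' ^ 2 ≤ 4 * δ ^ 2 :=
    calc 4 * dist m m' ^ 2 + dist a b ^ 2 + dist a' b' ^ 2
        = dist a a' ^ 2 + dist a b' ^ 2 + dist b a' ^ 2 + dist b b' ^ 2 :=
          four_mul_dist_midpoint_midpoint_sq_add a b a' b'
      _ ≤ δ ^ 2 + δ ^ 2 + δ ^ 2 + δ ^ 2 := by gcongr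
      _ = 4 * δ ^ 2 := by ring
  linarith

theorem dist_midpoint_midpoint_le_sqrt_mul_diam {S S' X : Set P} (hX : Bornology.IsBounded X)
    (hS : S ⊆ X) (hS' : S' ⊆ X) (hab : RealizesDiam S a b) (hab' : RealizesDiam S' a' b')
    (hSS' : (S ∩ S').Nonempty) :
    dist (midpoint ℝ a b) (midpoint ℝ a' b') ≤ √(7 / 8) * Metric.diam X := by
  obtain ⟨c, hc, hc'⟩ := hSS'
  obtain ⟨ha, hb, hdiam⟩ := hab
  obtain ⟨ha', hb', hdiam'⟩ := hab'
  have dist_le {Y : Set P} (hY : Y ⊆ X) {p q : P} (hp : p ∈ Y) (hq : q ∈ Y) :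
      dist p q ≤ Metric.diam Y := Metric.dist_le_diam_of_mem (hX.subset hY) hp hq
  have dist_le_diam_X {p q : P} (hp : p ∈ S) (hq : q ∈ S') : dist p q ≤ Metric.diam X :=
    dist_le subset_rfl (hS hp) (hS' hq)
  have hsq : dist (midpoint ℝ a b) (midpoint ℝ a' b') ^ 2 ≤ 6 / 7 * Metric.diam X ^ 2 :=
    dist_midpoint_midpoint_sq_le (hdiam ▸ dist_le hS hc ha) (hdiam ▸ dist_le hS hc hb)
      (hdiam' ▸ dist_le hS' hc' ha') (hdiam' ▸ dist_le hS' hc' hb') (dist_le_diam_X ha ha')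
      (dist_le_diam_X ha hb') (dist_le_diam_X hb ha') (dist_le_diam_X hb hb')
  refine le_of_sq_le_sq ?_ (mul_nonneg (Real.sqrt_nonneg _) Metric.diam_nonneg)
  rw [mul_pow, Real.sq_sqrt (by norm_num)]
  linarith [sq_nonneg (Metric.diam X)]

end Midpoints

/-! ### Quorums -/

section Quorums

theorem exists_mem_notMem_of_card_le {α : Type*} {B Q : Finset α} {f : ℕ} (hB : B.card ≤ f)
    (hQ : f < Q.card) : ∃ s ∈ Q, s ∉ B :=
  Finset.exists_mem_notMem_of_card_lt_card (hB.trans_lt hQ)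

variable {n f : ℕ} {B Q : Finset (Fin n)}

theorem add_card_le_card_inter_add (Q Q' : Finset (Fin n)) :
    Q.card + Q'.card ≤ (Q ∩ Q').card + n := by
  rw [← Finset.card_union_add_card_inter, add_comm]
  gcongr
  exact card_finset_fin_le _

theorem sub_le_card_of_forall_mem (hB : B.card ≤ f) (h : ∀ s ∉ B, s ∈ Q) : n - f ≤ Q.card :=
  calc n - f ≤ n - B.card := by gcongr
    _ = Bᶜ.card := by rw [Finset.card_compl, Fintype.card_fin]
    _ ≤ Q.card := Finset.card_le_card fun s hs => h s (Finset.mem_compl.1 hs)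

end Quorums

/-! ### Safe areas -/

namespace Coll

variable {n d : ℕ} {V W : Coll n d} {A : Finset (Fin n)} {o : Fin n}

/-- The diameter of the vectors of a multiset; for the multiset of the initial round this is the
estimate `e_i` of the paper. -/
def diam (V : Coll n d) : ℝ := Metric.diam (V.vals V.dom)

theorem mem_dom : o ∈ V.dom ↔ ∃ v, V o = some v := by
  simp [dom, Option.isSome_iff_exists]

theorem mem_common : o ∈ V.common W ↔ ∃ v, V o = some v ∧ W o = some v := by
  simp [common]

theorem finite_vals (V : Coll n d) (T : Finset (Fin n)) : (V.vals T).Finite := by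
  refine (T.finite_toSet.image fun o => (V o).getD 0).subset ?_
  rintro v ⟨o, ho, hv⟩
  exact ⟨o, ho, by simp [hv]⟩

theorem vals_mono (V : Coll n d) {T T' : Finset (Fin n)} (h : T ⊆ T') : V.vals T ⊆ V.vals T' :=
  fun _ ⟨o, ho, hv⟩ => ⟨o, h ho, hv⟩

theorem common_comm (V W : Coll n d) : V.common W = W.common V := by
  ext o
  simp only [mem_common, and_comm]

theorem common_subset_dom (V W : Coll n d) : V.common W ⊆ V.dom := fun _ ho =>
  let ⟨v, hv, _⟩ := mem_common.1 ho
  mem_dom.2 ⟨v, hv⟩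

theorem restrict_eq_some {v : Vec d} : V.restrict A o = some v ↔ o ∈ A ∧ V o = some v := by
  simp [restrict]

theorem dom_restrict (h : A ⊆ V.dom) : (V.restrict A).dom = A := by
  ext o
  simp only [mem_dom, restrict_eq_some, exists_and_left]
  exact and_iff_left_of_imp fun ho => mem_dom.1 (h ho)

theorem restrict_common (V W : Coll n d) :
    V.restrict (V.common W) = W.restrict (V.common W) := by
  ext o : 1
  refine Option.ext fun v => ?_
  simp only [restrict_eq_some, mem_common]
  grind

theorem ext_of_dom_eq (hdom : V.dom = W.dom)
    (h : ∀ o v w, V o = some v → W o = some w → v = w) : V = W := by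
  ext o : 1
  rcases hV : V o with _ | v <;> rcases hW : W o with _ | w
  · rfl
  · obtain ⟨v, hv⟩ := mem_dom.1 (hdom ▸ mem_dom.2 ⟨w, hW⟩)
    simp [hV] at hv
  · obtain ⟨w, hw⟩ := mem_dom.1 (hdom ▸ mem_dom.2 ⟨v, hV⟩)
    simp [hW] at hw
  · rw [h o v w hV hW]

end Coll

section SafeArea

variable {n d f : ℕ} {V W : Coll n d} {A T B : Finset (Fin n)}

theorem safeArea_eq_biInter (f : ℕ) (V : Coll n d) :
    safeArea f V = ⋂ T ∈ Finset.powersetCard (V.dom.card - f) V.dom, convexHull ℝ (V.vals T) := by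
  ext p
  simp [safeArea, Finset.mem_powersetCard, and_imp]

theorem convex_safeArea (V : Coll n d) : Convex ℝ (safeArea f V) := by
  rw [safeArea_eq_biInter]
  exact convex_iInter₂ fun T _ => convex_convexHull ℝ _

theorem safeArea_subset_convexHull_vals (hT : T ⊆ V.dom) (hc : V.dom.card ≤ T.card + f) :
    safeArea f V ⊆ convexHull ℝ (V.vals T) := by
  obtain ⟨T', hT', hc'⟩ := Finset.exists_subset_card_eq
    (show V.dom.card - f ≤ T.card by omega)
  exact fun p hp => convexHull_mono (V.vals_mono hT') (hp T' (hT'.trans hT) hc')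

theorem isCompact_safeArea (V : Coll n d) : IsCompact (safeArea f V) := by
  have isCompact_hull (T) : IsCompact (convexHull ℝ (V.vals T)) :=
    (V.finite_vals T).isCompact_convexHull ℝ
  refine (isCompact_hull V.dom).of_isClosed_subset ?_
    (safeArea_subset_convexHull_vals subset_rfl (Nat.le_add_right _ f))
  rw [safeArea_eq_biInter]
  exact isClosed_biInter fun T _ => (isCompact_hull T).isClosed

theorem safeArea_restrict_subset (h : A ⊆ V.dom) : safeArea f (V.restrict A) ⊆ safeArea f V := by
  intro p hp T hT hc
  have hcard : A.card + T.card ≤ (T ∩ A).card + V.dom.card := by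
    have := Finset.card_union_add_card_inter T A
    have := Finset.card_le_card (Finset.union_subset hT h)
    omega
  have hsub : (V.restrict A).vals (T ∩ A) ⊆ V.vals T := by
    rintro v ⟨o, ho, hv⟩
    exact ⟨o, (Finset.mem_inter.1 ho).1, (Coll.restrict_eq_some.1 hv).2⟩
  refine convexHull_mono hsub (safeArea_subset_convexHull_vals ?_ ?_ hp) <;>
    rw [Coll.dom_restrict h]
  · exact Finset.inter_subset_right
  · omega

theorem safeArea_nonempty (hV : (d + 1) * f < V.dom.card) : (safeArea f V).Nonempty := by
  rw [safeArea_eq_biInter]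
  refine Convex.helly_theorem' (𝕜 := ℝ) (fun T _ => convex_convexHull ℝ _) fun I hI hcard => ?_
  rw [finrank_euclideanSpace_fin] at hcard
  have omitted_lt : (I.biUnion fun T => V.dom \ T).card < V.dom.card :=
    calc (I.biUnion fun T => V.dom \ T).card ≤ I.card * f := by
          refine Finset.card_biUnion_le_card_mul _ _ _ fun T hT => ?_
          obtain ⟨hTV, hTc⟩ := Finset.mem_powersetCard.1 (hI hT)
          rw [Finset.card_sdiff_of_subset hTV]
          omega
      _ ≤ (d + 1) * f := by gcongr
      _ < V.dom.card := hV
  obtain ⟨o, ho, hno⟩ := Finset.exists_mem_notMem_of_card_lt_card omitted_lt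
  obtain ⟨v, hv⟩ := Coll.mem_dom.1 ho
  have mem_of_mem (T) (hT : T ∈ I) : o ∈ T := by
    by_contra hoT
    exact hno (Finset.mem_biUnion.2 ⟨T, hT, Finset.mem_sdiff.2 ⟨ho, hoT⟩⟩)
  exact ⟨v, Set.mem_iInter₂.2 fun T hT => subset_convexHull ℝ _ ⟨o, mem_of_mem T hT, hv⟩⟩

theorem safeArea_inter_nonempty (h : (d + 1) * f < (V.common W).card) :
    (safeArea f V ∩ safeArea f W).Nonempty := by
  have hV := V.common_subset_dom W
  have hW : V.common W ⊆ W.dom := V.common_comm W ▸ W.common_subset_dom V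
  obtain ⟨p, hp⟩ := safeArea_nonempty (V := V.restrict (V.common W))
    (by rwa [Coll.dom_restrict hV])
  exact ⟨p, safeArea_restrict_subset hV hp,
    safeArea_restrict_subset hW (V.restrict_common W ▸ hp)⟩

theorem safeArea_subset_convexHull (hB : B.card ≤ f) {s : Set (Vec d)}
    (h : ∀ o ∉ B, ∀ v, V o = some v → v ∈ s) : safeArea f V ⊆ convexHull ℝ s := by
  have hcard : V.dom.card ≤ (V.dom \ B).card + f := by
    have := Finset.le_card_sdiff B V.dom
    omega
  refine (safeArea_subset_convexHull_vals Finset.sdiff_subset hcard).trans (convexHull_mono ?_)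
  rintro v ⟨o, ho, hv⟩
  exact h o (Finset.mem_sdiff.1 ho).2 v hv

end SafeArea

section CorrectHull

variable {n d : ℕ} {B : Finset (Fin n)} {z : Fin n → Vec d} {i : Fin n}

/-- The convex hull of the vectors of the correct agents. -/
def correctHull (B : Finset (Fin n)) (z : Fin n → Vec d) : Set (Vec d) :=
  convexHull ℝ (z '' {i | i ∉ B})

theorem mem_correctHull (hi : i ∉ B) : z i ∈ correctHull B z :=
  subset_convexHull ℝ _ ⟨i, hi, rfl⟩

theorem correctHull_subset {s : Set (Vec d)} (hs : Convex ℝ s) (h : ∀ i ∉ B, z i ∈ s) :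
    correctHull B z ⊆ s :=
  convexHull_min (Set.image_subset_iff.2 h) hs

theorem isBounded_correctHull (B : Finset (Fin n)) (z : Fin n → Vec d) :
    Bornology.IsBounded (correctHull B z) :=
  isBounded_convexHull.2 (Set.toFinite _).isBounded

theorem diam_correctHull (B : Finset (Fin n)) (z : Fin n → Vec d) :
    Metric.diam (correctHull B z) = correctDiam B z :=
  convexHull_diam _

theorem correctDiam_le_of_forall_dist_le {C : ℝ} (hC : 0 ≤ C)
    (h : ∀ i ∉ B, ∀ j ∉ B, dist (z i) (z j) ≤ C) : correctDiam B z ≤ C := by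
  refine Metric.diam_le_of_forall_dist_le hC ?_
  rintro _ ⟨i, hi, rfl⟩ _ ⟨j, hj, rfl⟩
  exact h i hi j hj

theorem correctDiam_le_diam {s : Set (Vec d)} (hs : Bornology.IsBounded s)
    (h : ∀ i ∉ B, z i ∈ s) : correctDiam B z ≤ Metric.diam s :=
  correctDiam_le_of_forall_dist_le Metric.diam_nonneg fun i hi j hj =>
    Metric.dist_le_diam_of_mem hs (h i hi) (h j hj)

end CorrectHull

/-! ### Numbers of rounds -/

theorem one_lt_sqrt_eight_sevenths : 1 < √(8 / 7 : ℝ) := by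
  rw [Real.lt_sqrt] <;> norm_num

theorem sqrt_pow_midRounds_mul_le {ε D : ℝ} (hε : 0 < ε) : √(7 / 8) ^ midRounds ε D * D ≤ ε := by
  rcases le_or_gt D 0 with hD | hD
  · exact (mul_nonpos_of_nonneg_of_nonpos (by positivity) hD).trans hε.le
  have hpow : D / ε ≤ √(8 / 7) ^ midRounds ε D := by
    rw [← Real.rpow_natCast,
      ← Real.logb_le_iff_le_rpow one_lt_sqrt_eight_sevenths (by positivity)]
    exact Nat.le_ceil _
  have hinv : √(7 / 8) * √(8 / 7 : ℝ) = 1 := by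
    rw [← Real.sqrt_mul (by norm_num)]
    norm_num
  calc √(7 / 8) ^ midRounds ε D * D
      ≤ √(7 / 8) ^ midRounds ε D * (√(8 / 7) ^ midRounds ε D * ε) := by
        gcongr
        exact (div_le_iff₀ hε).1 hpow
    _ = ε := by rw [← mul_assoc, ← mul_pow, hinv, one_pow, one_mul]

theorem midRounds_mono {ε D D' : ℝ} (hε : 0 < ε) (hD : 0 ≤ D) (h : D ≤ D') :
    midRounds ε D ≤ midRounds ε D' := by
  rcases hD.eq_or_lt with rfl | hD
  · simp [midRounds]
  · exact Nat.ceil_mono (Real.logb_le_logb_of_le one_lt_sqrt_eight_sevenths (by positivity)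
      (by gcongr))

theorem half_mul_logb_le_mul_coordRounds {d : ℕ} {ε Δ D : ℝ} (hd : 1 ≤ d) (hε : 0 < ε)
    (hΔ : ε ≤ Δ) (hD : Δ ≤ D) :
    1 / 2 * (d * Real.logb 2 (d * Δ / ε)) ≤ (d * coordRounds d ε D : ℕ) := by
  have hd' : (0 : ℝ) < d := by exact_mod_cast hd
  have hΔ' : 0 < Δ := hε.trans_le hΔ
  have logb_nonneg : 0 ≤ Real.logb 2 (Δ / ε) :=
    Real.logb_nonneg one_lt_two ((one_le_div hε).2 hΔ)
  have half_logb_le : 1 / 2 * Real.logb 2 (d * Δ / ε) ≤ coordRounds d ε D :=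
    calc 1 / 2 * Real.logb 2 (d * Δ / ε)
        = 1 / 2 * (Real.logb 2 d + Real.logb 2 (Δ / ε)) := by
          rw [mul_div_assoc, Real.logb_mul hd'.ne' (by positivity)]
      _ ≤ 1 / 2 * Real.logb 2 d + Real.logb 2 (Δ / ε) := by linarith
      _ = Real.logb 2 (√d * Δ / ε) := by
          rw [mul_div_assoc, Real.logb_mul (by positivity) (by positivity), Real.sqrt_eq_rpow,
            Real.logb_rpow_eq_mul_logb_of_pos hd']
      _ ≤ Real.logb 2 (√d * D / ε) :=
          Real.logb_le_logb_of_le one_lt_two (by positivity) (by gcongr)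
      _ ≤ coordRounds d ε D := Nat.le_ceil _
  push_cast
  linarith [mul_le_mul_of_nonneg_left half_logb_le hd'.le]

/-! ### Local states -/

namespace LocalState

variable {n d f k t : ℕ} {R : Rule d} {st st' : LocalState n d} {s j o : Fin n} {m : Msg n d}
  {it : Item n d} {A : Finset (Fin n)} {V : Coll n d}

/-- The state between the two parts of the reaction to a message: the message has been recorded and
the reliable broadcast has reacted to it, but the round structure has not. -/
def relayed (f : ℕ) (st : LocalState n d) (s : Fin n) (m : Msg n d) : LocalState n d :=
  relay f { st with rcv := insert (s, m) st.rcv } s m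

theorem receive_eq_progress_relayed : st.receive f R s m = (st.relayed f s m).progress f R := rfl

theorem relayed_eq : st.relayed f s m =
    { st with rcv := insert (s, m) st.rcv, sent := (st.relayed f s m).sent } := by
  unfold relayed
  cases m <;> simp only [relay] <;> split_ifs <;> rfl

theorem rcv_relayed : (st.relayed f s m).rcv = insert (s, m) st.rcv := by rw [relayed_eq]

theorem round_relayed : (st.relayed f s m).round = st.round := by rw [relayed_eq]

theorem val_relayed : (st.relayed f s m).val = st.val := by rw [relayed_eq]

theorem coll_relayed : (st.relayed f s m).coll = st.coll := by rw [relayed_eq]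

theorem est_relayed : (st.relayed f s m).est = st.est := by rw [relayed_eq]

theorem init_mem_sent_relayed : Msg.init it ∈ (st.relayed f s m).sent ↔ Msg.init it ∈ st.sent := by
  unfold relayed
  cases m <;> simp only [relay] <;> split_ifs <;> simp

theorem rcv_progress : (st.progress f R).rcv = st.rcv := by
  unfold progress advance
  split_ifs <;> rfl

theorem echo_mem_sent_progress :
    Msg.echo o it ∈ (st.progress f R).sent ↔ Msg.echo o it ∈ st.sent := by
  unfold progress advance
  split_ifs <;> simp

theorem ready_mem_sent_progress :
    Msg.ready o it ∈ (st.progress f R).sent ↔ Msg.ready o it ∈ st.sent := by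
  unfold progress advance
  split_ifs <;> simp

theorem rcv_receive : (st.receive f R s m).rcv = insert (s, m) st.rcv := by
  rw [receive_eq_progress_relayed, rcv_progress, rcv_relayed]

/-- `st'` arises from `st` without changing what has been recorded. -/
structure Extends (st st' : LocalState n d) : Prop where
  rcv : st.rcv ⊆ st'.rcv
  sent : st.sent ⊆ st'.sent
  round : st.round ≤ st'.round
  val : ∀ t ≤ st.round, st'.val t = st.val t
  coll : ∀ t < st.round, st'.coll t = st.coll t
  est : 0 < st.round → st'.est = st.est

theorem Extends.refl (st : LocalState n d) : Extends st st :=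
  ⟨subset_rfl, subset_rfl, le_rfl, fun _ _ => rfl, fun _ _ => rfl, fun _ => rfl⟩

theorem Extends.trans {st₁ st₂ st₃ : LocalState n d} (h : Extends st₁ st₂) (h' : Extends st₂ st₃) :
    Extends st₁ st₃ where
  rcv := h.rcv.trans h'.rcv
  sent := h.sent.trans h'.sent
  round := h.round.trans h'.round
  val t ht := (h'.val t (ht.trans h.round)).trans (h.val t ht)
  coll t ht := (h'.coll t (ht.trans_le h.round)).trans (h.coll t ht)
  est ht := (h'.est (ht.trans_le h.round)).trans (h.est ht)

theorem extends_relayed : Extends st (st.relayed f s m) where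
  rcv := rcv_relayed ▸ Set.subset_insert _ _
  sent := subset_relay f { st with rcv := insert (s, m) st.rcv } s m
  round := round_relayed.ge
  val _ _ := by rw [val_relayed]
  coll _ _ := by rw [coll_relayed]
  est _ := est_relayed

theorem extends_advance : Extends st (st.advance f R) where
  rcv := subset_rfl
  sent := Set.subset_insert _ _
  round := Nat.le_succ _
  val t ht := Function.update_of_ne (by omega) _ _
  coll t ht := Function.update_of_ne (by omega) _ _
  est ht := if_neg ht.ne'

theorem extends_progress : Extends st (st.progress f R) := by
  unfold progress
  split_ifs
  · exact extends_advance
  · exact Extends.refl _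
  · exact { Extends.refl st with sent := Set.subset_insert _ _ }
  · exact Extends.refl _

theorem extends_receive : Extends st (st.receive f R s m) :=
  extends_relayed.trans extends_progress

/-! ### Reliable broadcast: local invariants -/

theorem le_echoes_iff : k ≤ st.echoes o it ↔
    ∃ Q : Finset (Fin n), k ≤ Q.card ∧ ∀ s ∈ Q, (s, Msg.echo o it) ∈ st.rcv := by
  refine ⟨fun h => ⟨_, h, fun s hs => ?_⟩, fun ⟨Q, hQ, h⟩ => hQ.trans (Finset.card_le_card ?_)⟩
  · simpa only [Finset.mem_filter, Finset.mem_univ, true_and] using hs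
  · simpa only [Finset.subset_iff, Finset.mem_filter, Finset.mem_univ, true_and] using h

theorem le_readies_iff : k ≤ st.readies o it ↔
    ∃ Q : Finset (Fin n), k ≤ Q.card ∧ ∀ s ∈ Q, (s, Msg.ready o it) ∈ st.rcv := by
  refine ⟨fun h => ⟨_, h, fun s hs => ?_⟩, fun ⟨Q, hQ, h⟩ => hQ.trans (Finset.card_le_card ?_)⟩
  · simpa only [Finset.mem_filter, Finset.mem_univ, true_and] using hs
  · simpa only [Finset.subset_iff, Finset.mem_filter, Finset.mem_univ, true_and] using h

theorem echoes_mono (h : st.rcv ⊆ st'.rcv) : st.echoes o it ≤ st'.echoes o it :=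
  have ⟨Q, hQ, hrcv⟩ := le_echoes_iff.1 le_rfl
  le_echoes_iff.2 ⟨Q, hQ, fun s hs => h (hrcv s hs)⟩

theorem readies_mono (h : st.rcv ⊆ st'.rcv) : st.readies o it ≤ st'.readies o it :=
  have ⟨Q, hQ, hrcv⟩ := le_readies_iff.1 le_rfl
  le_readies_iff.2 ⟨Q, hQ, fun s hs => h (hrcv s hs)⟩

theorem not_delivered_of_rcv_eq_empty (h : st.rcv = ∅) : ¬ st.Delivered f o it := by
  simp [Delivered, readies, h]

theorem echoes_congr (h : st.rcv = st'.rcv) : st.echoes o it = st'.echoes o it :=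
  (echoes_mono h.subset).antisymm (echoes_mono h.symm.subset)

theorem readies_congr (h : st.rcv = st'.rcv) : st.readies o it = st'.readies o it :=
  (readies_mono h.subset).antisymm (readies_mono h.symm.subset)

theorem Delivered.mono (hd : st.Delivered f o it) (h : st.rcv ⊆ st'.rcv) :
    st'.Delivered f o it :=
  hd.trans (readies_mono h)

theorem echoes_receive_of_ne (h : m ≠ .echo o it) :
    (st.receive f R s m).echoes o it = st.echoes o it := by
  refine eq_of_forall_le_iff fun k => ?_
  simp [le_echoes_iff, rcv_receive, h.symm]

theorem readies_receive_of_ne (h : m ≠ .ready o it) :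
    (st.receive f R s m).readies o it = st.readies o it := by
  refine eq_of_forall_le_iff fun k => ?_
  simp [le_readies_iff, rcv_receive, h.symm]

theorem echo_mem_sent_receive : Msg.echo o it ∈ (st.receive f R s m).sent ↔
    Msg.echo o it ∈ st.sent ∨ m = .init it ∧ s = o ∧
      ∀ it' : Item n d, it'.key = it.key → Msg.echo o it' ∉ st.sent := by
  rw [receive_eq_progress_relayed, echo_mem_sent_progress]
  unfold relayed
  cases m <;> simp only [relay] <;> split_ifs <;> grind

theorem ready_mem_sent_receive : Msg.ready o it ∈ (st.receive f R s m).sent ↔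
    Msg.ready o it ∈ st.sent ∨
      (m = .echo o it ∧ n - f ≤ (st.receive f R s m).echoes o it ∨
        m = .ready o it ∧ f + 1 ≤ (st.receive f R s m).readies o it) ∧
      ∀ it' : Item n d, it'.key = it.key → Msg.ready o it' ∉ st.sent := by
  have hrcv : (st.receive f R s m).rcv = { st with rcv := insert (s, m) st.rcv }.rcv := rcv_receive
  rw [echoes_congr hrcv, readies_congr hrcv, receive_eq_progress_relayed, ready_mem_sent_progress]
  unfold relayed
  cases m <;> simp only [relay] <;> split_ifs <;> grind

theorem exists_ready_mem_sent_receive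
    (h : m = .echo o it ∧ n - f ≤ (st.receive f R s m).echoes o it ∨
      m = .ready o it ∧ f + 1 ≤ (st.receive f R s m).readies o it) :
    ∃ it' : Item n d, it'.key = it.key ∧ Msg.ready o it' ∈ (st.receive f R s m).sent := by
  by_cases hnew : ∀ it' : Item n d, it'.key = it.key → Msg.ready o it' ∉ st.sent
  · exact ⟨it, rfl, ready_mem_sent_receive.2 (.inr ⟨h, hnew⟩)⟩
  · push Not at hnew
    obtain ⟨it', hkey, hsent⟩ := hnew
    exact ⟨it', hkey, extends_receive.sent hsent⟩

/-- What the reliable broadcast guarantees about the messages sent and received by a correct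
agent. -/
structure BroadcastInv (f : ℕ) (st : LocalState n d) : Prop where
  echo_unique : ∀ o (it it' : Item n d), it.key = it'.key → Msg.echo o it ∈ st.sent →
    Msg.echo o it' ∈ st.sent → it = it'
  init_of_echo : ∀ o (it : Item n d), Msg.echo o it ∈ st.sent → (o, Msg.init it) ∈ st.rcv
  quorum_of_ready : ∀ o (it : Item n d), Msg.ready o it ∈ st.sent →
    n - f ≤ st.echoes o it ∨ f + 1 ≤ st.readies o it
  exists_echo : ∀ o (it : Item n d), (o, Msg.init it) ∈ st.rcv →
    ∃ it' : Item n d, it'.key = it.key ∧ Msg.echo o it' ∈ st.sent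
  exists_ready_of_echoes : ∀ o (it : Item n d), 0 < st.echoes o it → n - f ≤ st.echoes o it →
    ∃ it' : Item n d, it'.key = it.key ∧ Msg.ready o it' ∈ st.sent
  exists_ready_of_readies : ∀ o (it : Item n d), f + 1 ≤ st.readies o it →
    ∃ it' : Item n d, it'.key = it.key ∧ Msg.ready o it' ∈ st.sent

theorem BroadcastInv.receive (h : BroadcastInv f st) : BroadcastInv f (st.receive f R s m) := by
  have hext : Extends st (st.receive f R s m) := extends_receive
  constructor
  · intro o it it' hkey hit hit'
    have := h.echo_unique o it it' hkey
    rw [echo_mem_sent_receive] at hit hit'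
    grind
  · intro o it hit
    rw [rcv_receive]
    rcases echo_mem_sent_receive.1 hit with hit | ⟨rfl, rfl, -⟩
    · exact Set.mem_insert_of_mem _ (h.init_of_echo o it hit)
    · exact Set.mem_insert _ _
  · intro o it hit
    rcases ready_mem_sent_receive.1 hit with hit | ⟨hquorum, -⟩
    · exact (h.quorum_of_ready o it hit).imp (fun hle => hle.trans (echoes_mono hext.rcv))
        fun hle => hle.trans (readies_mono hext.rcv)
    · exact hquorum.imp And.right And.right
  · intro o it hit
    by_cases hnew : ∀ it' : Item n d, it'.key = it.key → Msg.echo o it' ∉ st.sent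
    · have hm : s = o ∧ m = .init it := by
        have := h.exists_echo o it
        rw [rcv_receive] at hit
        grind
      exact ⟨it, rfl, echo_mem_sent_receive.2 (.inr ⟨hm.2, hm.1, hnew⟩)⟩
    · push Not at hnew
      exact hnew.imp fun it' => And.imp_right (hext.sent ·)
  · intro o it hpos hle
    by_cases hm : m = .echo o it
    · exact exists_ready_mem_sent_receive (.inl ⟨hm, hle⟩)
    · rw [echoes_receive_of_ne hm] at hpos hle
      exact (h.exists_ready_of_echoes o it hpos hle).imp fun it' => And.imp_right (hext.sent ·)
  · intro o it hle
    by_cases hm : m = .ready o it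
    · exact exists_ready_mem_sent_receive (.inr ⟨hm, hle⟩)
    · rw [readies_receive_of_ne hm] at hle
      exact (h.exists_ready_of_readies o it hle).imp fun it' => And.imp_right (hext.sent ·)

theorem broadcastInv_init (f : ℕ) (R : Rule d) (x : Vec d) :
    BroadcastInv f ((roundProtocol n d f R).init x) := by
  constructor <;> simp +contextual [roundProtocol, echoes, readies]

/-! ### Rounds: local invariants -/

theorem delivered_of_values_eq_some {v : Vec d} (h : st.values f t o = some v) :
    st.Delivered f o (.value t v) := by
  unfold values at h
  split_ifs at h with h'
  exact Option.some.inj h ▸ h'.choose_spec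

theorem mem_dom_values : o ∈ (st.values f t).dom ↔ ∃ v, st.Delivered f o (.value t v) := by
  rw [Coll.mem_dom]
  exact ⟨.imp fun _ => delivered_of_values_eq_some, fun h => ⟨_, dif_pos h⟩⟩

theorem reportOf_eq_some (h : st.reportOf f t j = some A) :
    st.Delivered f j (.report t A) ∧ n - f ≤ A.card ∧ A ⊆ (st.values f t).dom := by
  unfold reportOf at h
  split_ifs at h with h'
  exact Option.some.inj h ▸ h'.choose_spec

theorem mem_witnesses : j ∈ st.witnesses f t ↔
    ∃ A, st.Delivered f j (.report t A) ∧ n - f ≤ A.card ∧ A ⊆ (st.values f t).dom := by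
  simp only [witnesses, Finset.mem_filter, Finset.mem_univ, true_and, Option.isSome_iff_exists]
  exact ⟨.imp fun _ => reportOf_eq_some, fun h => ⟨_, dif_pos h⟩⟩

theorem witnesses_mono (h : st.rcv ⊆ st'.rcv) : st.witnesses f t ⊆ st'.witnesses f t := by
  intro j hj
  obtain ⟨A, hreport, hcard, hsub⟩ := mem_witnesses.1 hj
  exact mem_witnesses.2 ⟨A, hreport.mono h, hcard, fun o ho =>
    mem_dom_values.2 ((mem_dom_values.1 (hsub ho)).imp fun _ hv => hv.mono h)⟩

/-- What an agent has broadcast on its own account: its vectors and its reports. -/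
structure SentInv (f : ℕ) (st : LocalState n d) : Prop where
  value_iff : ∀ t v, Msg.init (.value t v) ∈ st.sent ↔ t ≤ st.round ∧ v = st.val t
  report_unique : ∀ t A A', Msg.init (.report t A) ∈ st.sent →
    Msg.init (.report t A') ∈ st.sent → A = A'
  exists_report : ∀ t < st.round, ∃ A, Msg.init (.report t A) ∈ st.sent
  report_le : ∀ t A, Msg.init (.report t A) ∈ st.sent → t ≤ st.round
  report_valid : ∀ t A, Msg.init (.report t A) ∈ st.sent →
    n - f ≤ A.card ∧ ∀ o ∈ A, ∃ v, st.Delivered f o (.value t v)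

theorem SentInv.relayed (h : SentInv f st) : SentInv f (st.relayed f s m) where
  value_iff t v := by rw [init_mem_sent_relayed, round_relayed, val_relayed, h.value_iff]
  report_unique t A A' := by
    rw [init_mem_sent_relayed, init_mem_sent_relayed]
    exact h.report_unique t A A'
  exists_report t := by
    simp only [init_mem_sent_relayed, round_relayed]
    exact h.exists_report t
  report_le t A := by
    rw [init_mem_sent_relayed, round_relayed]
    exact h.report_le t A
  report_valid t A := by
    rw [init_mem_sent_relayed]
    exact fun hA => (h.report_valid t A hA).imp_right fun hdel o ho =>
      (hdel o ho).imp fun _ hv => hv.mono extends_relayed.rcv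

theorem SentInv.insert_report (h : SentInv f st) (hr : ¬ st.Reported)
    (hc : n - f ≤ (st.values f st.round).dom.card) :
    SentInv f { st with
      sent := insert (Msg.init (.report st.round (st.values f st.round).dom)) st.sent } where
  value_iff t v := by simpa using h.value_iff t v
  report_unique t A A' hA hA' := by
    have := h.report_unique t A A'
    unfold Reported at hr
    simp only [Set.mem_insert_iff, Msg.init.injEq, Item.report.injEq] at hA hA'
    grind
  exists_report t ht := (h.exists_report t ht).imp fun _ => Set.mem_insert_of_mem _
  report_le t A hA := by
    simp only [Set.mem_insert_iff, Msg.init.injEq, Item.report.injEq] at hA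
    exact hA.elim (fun hA => hA.1.le) (h.report_le t A)
  report_valid t A hA := by
    simp only [Set.mem_insert_iff, Msg.init.injEq, Item.report.injEq] at hA
    rcases hA with ⟨rfl, rfl⟩ | hA
    · exact ⟨hc, fun o ho => mem_dom_values.1 ho⟩
    · exact h.report_valid t A hA

theorem value_mem_sent_advance {v : Vec d} : Msg.init (.value t v) ∈ (st.advance f R).sent ↔
    t = st.round + 1 ∧ v = (st.advance f R).val (st.round + 1) ∨
      Msg.init (.value t v) ∈ st.sent := by
  simp [advance]

theorem report_mem_sent_advance :
    Msg.init (.report t A) ∈ (st.advance f R).sent ↔ Msg.init (.report t A) ∈ st.sent := by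
  simp [advance]

theorem SentInv.advance (h : SentInv f st) (hr : st.Reported) : SentInv f (st.advance f R) where
  value_iff t v := by
    have hval := (extends_advance (st := st) (f := f) (R := R)).val t
    rw [value_mem_sent_advance, h.value_iff]
    change _ ↔ t ≤ st.round + 1 ∧ _
    grind
  report_unique t A A' := by
    rw [report_mem_sent_advance, report_mem_sent_advance]
    exact h.report_unique t A A'
  exists_report t ht := by
    simp only [report_mem_sent_advance]
    rcases Nat.lt_succ_iff_lt_or_eq.1 ht with ht | rfl
    exacts [h.exists_report t ht, hr]
  report_le t A hA := (h.report_le t A (report_mem_sent_advance.1 hA)).trans (Nat.le_succ _)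
  report_valid t A hA := h.report_valid t A (report_mem_sent_advance.1 hA)

theorem SentInv.receive (h : SentInv f st) : SentInv f (st.receive f R s m) := by
  rw [receive_eq_progress_relayed]
  unfold progress
  split_ifs with hr hc hc
  · exact h.relayed.advance hr
  · exact h.relayed
  · exact h.relayed.insert_report hr hc
  · exact h.relayed

theorem exists_report_mem_sent_progress (hc : n - f ≤ (st.values f st.round).dom.card) :
    ∃ A, Msg.init (.report st.round A) ∈ (st.progress f R).sent := by
  by_cases hr : st.Reported
  · exact hr.imp fun A hA => extends_progress.sent hA
  · rw [progress, if_neg hr, if_pos hc]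
    exact ⟨_, Set.mem_insert _ _⟩

theorem round_progress_of_reported (hr : st.Reported)
    (hc : n - f ≤ (st.witnesses f st.round).card) : (st.progress f R).round = st.round + 1 := by
  rw [progress, if_pos hr, if_pos hc, advance]

theorem sentInv_init (f : ℕ) (R : Rule d) (x : Vec d) :
    SentInv f ((roundProtocol n d f R).init x) := by
  constructor <;> simp [roundProtocol]

/-- `V` qualifies as the multiset used in a round `t ≥ 1`: it consists of delivered vectors and
contains what `n - f` witnesses have reported. -/
structure IsRoundColl (f : ℕ) (st : LocalState n d) (t : ℕ) (V : Coll n d) : Prop where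
  delivered : ∀ o v, V o = some v → st.Delivered f o (.value t v)
  exists_witnesses : ∃ W : Finset (Fin n), n - f ≤ W.card ∧ ∀ j ∈ W, ∃ A : Finset (Fin n),
    st.Delivered f j (.report t A) ∧ n - f ≤ A.card ∧ A ⊆ V.dom

/-- `V` qualifies as the multiset `U_i` of the initial round: the points in it are selected in the
safe areas of what `n - f` witnesses have reported. -/
structure IsEstimateColl (f : ℕ) (R : Rule d) (st : LocalState n d) (V : Coll n d) : Prop where
  card_dom : n - f ≤ V.dom.card
  exists_report : ∀ j u, V j = some u → ∃ X : Coll n d,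
    st.Delivered f j (.report 0 X.dom) ∧ n - f ≤ X.dom.card ∧
    (∀ o v, X o = some v → st.Delivered f o (.value 0 v)) ∧ u = R.point 0 (safeArea f X)

theorem IsRoundColl.mono (hV : IsRoundColl f st t V) (h : st.rcv ⊆ st'.rcv) :
    IsRoundColl f st' t V where
  delivered o v hv := (hV.delivered o v hv).mono h
  exists_witnesses := by
    obtain ⟨W, hW, hreport⟩ := hV.exists_witnesses
    exact ⟨W, hW, fun j hj => (hreport j hj).imp fun A => And.imp_left (·.mono h)⟩

theorem IsEstimateColl.mono (hV : IsEstimateColl f R st V) (h : st.rcv ⊆ st'.rcv) :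
    IsEstimateColl f R st' V where
  card_dom := hV.card_dom
  exists_report j u hu := by
    obtain ⟨X, hreport, hcard, hX, hpoint⟩ := hV.exists_report j u hu
    exact ⟨X, hreport.mono h, hcard, fun o v hv => (hX o v hv).mono h, hpoint⟩

theorem isRoundColl_current (h0 : 0 < st.round) (hc : n - f ≤ (st.witnesses f st.round).card) :
    IsRoundColl f st st.round (st.current f R) := by
  rw [current, if_neg h0.ne']
  exact ⟨fun o v => delivered_of_values_eq_some, _, hc, fun j hj => mem_witnesses.1 hj⟩

theorem isEstimateColl_current (h0 : st.round = 0)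
    (hc : n - f ≤ (st.witnesses f st.round).card) :
    IsEstimateColl f R st (st.current f R) := by
  rw [h0] at hc
  rw [current, if_pos h0]
  refine ⟨hc.trans (Finset.card_le_card fun j hj => ?_), fun j u hu => ?_⟩
  · simpa [witnesses, Coll.dom] using hj
  · obtain ⟨A, hA, rfl⟩ := Option.map_eq_some_iff.1 hu
    obtain ⟨hreport, hcard, hsub⟩ := reportOf_eq_some hA
    have hdom := Coll.dom_restrict hsub
    exact ⟨(st.values f 0).restrict A, hdom.symm ▸ hreport, hdom.symm ▸ hcard,
      fun o v hv => delivered_of_values_eq_some (Coll.restrict_eq_some.1 hv).2, rfl⟩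

/-- How the vectors, the multisets and the estimate recorded by an agent arose. -/
structure HistoryInv (f : ℕ) (R : Rule d) (st : LocalState n d) : Prop where
  val_succ : ∀ t < st.round, st.val (t + 1) = R.point t (safeArea f (st.coll t))
  est_eq : 0 < st.round → st.est = (st.coll 0).diam
  coll_zero : 0 < st.round → IsEstimateColl f R st (st.coll 0)
  coll_pos : ∀ t < st.round, 0 < t → IsRoundColl f st t (st.coll t)

theorem HistoryInv.of_rcv_subset (h : HistoryInv f R st) (hrcv : st.rcv ⊆ st'.rcv)
    (hround : st'.round = st.round) (hval : st'.val = st.val) (hcoll : st'.coll = st.coll)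
    (hest : st'.est = st.est) : HistoryInv f R st' where
  val_succ := by rw [hround, hval, hcoll]; exact h.val_succ
  est_eq := by rw [hround, hest, hcoll]; exact h.est_eq
  coll_zero := by rw [hround, hcoll]; exact fun h0 => (h.coll_zero h0).mono hrcv
  coll_pos := by rw [hround, hcoll]; exact fun t ht h0 => (h.coll_pos t ht h0).mono hrcv

theorem HistoryInv.relayed (h : HistoryInv f R st) : HistoryInv f R (st.relayed f s m) :=
  h.of_rcv_subset extends_relayed.rcv round_relayed val_relayed coll_relayed est_relayed

theorem val_advance_round_add_one : (st.advance f R).val (st.round + 1) =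
    R.point st.round (safeArea f (st.current f R)) :=
  Function.update_self ..

theorem coll_advance_round : (st.advance f R).coll st.round = st.current f R :=
  Function.update_self ..

theorem HistoryInv.advance (h : HistoryInv f R st)
    (hc : n - f ≤ (st.witnesses f st.round).card) : HistoryInv f R (st.advance f R) := by
  have hext : Extends st (st.advance f R) := extends_advance
  constructor
  · intro t ht
    rcases Nat.lt_succ_iff_lt_or_eq.1 ht with ht | rfl
    · rw [hext.val _ ht, hext.coll _ ht, h.val_succ t ht]
    · rw [val_advance_round_add_one, coll_advance_round]
  · intro _
    rcases Nat.eq_zero_or_pos st.round with h0 | h0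
    · rw [← h0, coll_advance_round]
      exact if_pos h0
    · rw [hext.est h0, hext.coll 0 h0, h.est_eq h0]
  · intro _
    rcases Nat.eq_zero_or_pos st.round with h0 | h0
    · rw [← h0, coll_advance_round]
      exact (isEstimateColl_current h0 hc).mono hext.rcv
    · rw [hext.coll 0 h0]
      exact (h.coll_zero h0).mono hext.rcv
  · intro t ht h0
    rcases Nat.lt_succ_iff_lt_or_eq.1 ht with ht | rfl
    · rw [hext.coll t ht]
      exact (h.coll_pos t ht h0).mono hext.rcv
    · rw [coll_advance_round]
      exact (isRoundColl_current h0 hc).mono hext.rcv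

theorem HistoryInv.receive (h : HistoryInv f R st) : HistoryInv f R (st.receive f R s m) := by
  rw [receive_eq_progress_relayed]
  unfold progress
  split_ifs with hr hc hc
  · exact h.relayed.advance hc
  · exact h.relayed
  · exact h.relayed.of_rcv_subset subset_rfl rfl rfl rfl rfl
  · exact h.relayed

theorem historyInv_init (f : ℕ) (R : Rule d) (x : Vec d) :
    HistoryInv f R ((roundProtocol n d f R).init x) := by
  constructor <;> simp [roundProtocol]

end LocalState

/-! ### Executions -/

namespace Protocol

section State

variable {n k : ℕ} {In Msg St Out : Type} (P : Protocol n In Msg St Out) (x : Fin n → In)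
  (ev : Schedule n Msg) {s i : Fin n} {m : Msg}

theorem state_succ_of_event (h : ev k = some (s, i, m)) :
    P.state x ev (k + 1) i = P.recv (P.state x ev k i) s m := by
  rw [state, h]
  exact Function.update_self ..

theorem state_succ_eq (k : ℕ) (i : Fin n) : P.state x ev (k + 1) i = P.state x ev k i ∨
    ∃ s m, ev k = some (s, i, m) ∧ P.state x ev (k + 1) i = P.recv (P.state x ev k i) s m := by
  by_cases h : ∃ s m, ev k = some (s, i, m)
  · obtain ⟨s, m, h⟩ := h
    exact .inr ⟨s, m, h, P.state_succ_of_event x ev h⟩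
  · left
    rw [state]
    rcases hk : ev k with _ | ⟨s, r, m⟩
    · rfl
    · exact Function.update_of_ne (by grind) _ _

theorem state_induction {p : St → Prop} (hinit : ∀ v, p (P.init v))
    (hrecv : ∀ st s m, p st → p (P.recv st s m)) (k : ℕ) (i : Fin n) : p (P.state x ev k i) := by
  induction k with
  | zero => exact hinit _
  | succ k ih =>
    rcases P.state_succ_eq x ev k i with h | ⟨s, m, -, h⟩ <;> rw [h]
    exacts [ih, hrecv _ s m ih]

end State

section RoundProtocol

open LocalState Filter

variable {n d f : ℕ} {R : Rule d} {B : Finset (Fin n)} {x : Fin n → Vec d}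
  {ev : Schedule n (Msg n d)} {k l t : ℕ} {i j o s : Fin n} {m : Msg n d} {it it' : Item n d}

local notation "σ" => Protocol.state (roundProtocol n d f R) x ev

theorem broadcastInv_state (k : ℕ) (i : Fin n) : BroadcastInv f (σ k i) :=
  state_induction _ x ev (broadcastInv_init f R) (fun _ _ _ h => h.receive) k i

theorem sentInv_state (k : ℕ) (i : Fin n) : SentInv f (σ k i) :=
  state_induction _ x ev (sentInv_init f R) (fun _ _ _ h => h.receive) k i

theorem historyInv_state (k : ℕ) (i : Fin n) : HistoryInv f R (σ k i) :=
  state_induction _ x ev (historyInv_init f R) (fun _ _ _ h => h.receive) k i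

theorem extends_state (h : k ≤ l) (i : Fin n) : Extends (σ k i) (σ l i) := by
  induction l, h using Nat.le_induction with
  | base => exact Extends.refl _
  | succ l _ ih =>
    refine ih.trans ?_
    rcases (roundProtocol n d f R).state_succ_eq x ev l i with h | ⟨s, m, -, h⟩ <;> rw [h]
    exacts [Extends.refl _, extends_receive]

theorem init_mem_sent_unique (hkey : it.key = it'.key) (h : Msg.init it ∈ (σ k o).sent)
    (h' : Msg.init it' ∈ (σ l o).sent) : it = it' := by
  replace h := (extends_state (le_max_left k l) o).sent h
  replace h' := (extends_state (le_max_right k l) o).sent h'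
  have inv : SentInv f (σ (max k l) o) := sentInv_state _ o
  rcases it with ⟨t, v⟩ | ⟨t, A⟩ <;> rcases it' with ⟨t', v'⟩ | ⟨t', A'⟩ <;>
    simp only [Item.key, Prod.mk.injEq, and_true, and_false, reduceCtorEq] at hkey <;> subst hkey
  · rw [((inv.value_iff _ _).1 h).2, ((inv.value_iff _ _).1 h').2]
  · rw [inv.report_unique _ _ _ h h']

/-- Since the state of an agent only changes when it receives a message, a property of the received
messages becomes true in between the two parts of the reaction to one of them. -/
theorem exists_receive_of_exists_state {p : LocalState n d → Prop}
    (hp : ∀ st st', st.rcv ⊆ st'.rcv → p st → p st') (h0 : ¬ p (σ 0 i)) (h : ∃ k, p (σ k i)) :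
    ∃ k s m, σ (k + 1) i = ((σ k i).relayed f s m).progress f R ∧ p (σ (k + 1) i) ∧
      p ((σ k i).relayed f s m) := by
  obtain ⟨k, hk, hk'⟩ : ∃ k, ¬ p (σ k i) ∧ p (σ (k + 1) i) := by
    by_contra! hstep
    obtain ⟨k, hk⟩ := h
    exact (Nat.rec h0 hstep k : ¬ p (σ k i)) hk
  rcases (roundProtocol n d f R).state_succ_eq x ev k i with heq | ⟨s, m, -, heq⟩
  · exact absurd (heq ▸ hk') hk
  · refine ⟨k, s, m, heq, hk', hp _ _ ?_ hk'⟩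
    rw [heq]
    exact (rcv_receive.trans rcv_relayed.symm).subset

namespace IsExecution

variable (he : (roundProtocol n d f R).IsExecution B x ev)
include he

theorem exists_lt_mem_sent_of_mem_rcv (hs : s ∉ B) (h : (s, m) ∈ (σ k i).rcv) :
    ∃ l < k, m ∈ (σ l s).sent := by
  induction k with
  | zero => exact absurd h (Set.notMem_empty _)
  | succ k ih =>
    have of_mem (h : (s, m) ∈ (σ k i).rcv) : ∃ l < k + 1, m ∈ (σ l s).sent :=
      (ih h).imp fun l => And.imp_left Nat.lt_succ_of_lt
    rcases (roundProtocol n d f R).state_succ_eq x ev k i with heq | ⟨s', m', hev, heq⟩ <;>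
      rw [heq] at h
    · exact of_mem h
    · rcases rcv_receive.subset h with h | h
      · obtain ⟨rfl, rfl⟩ := Prod.mk.inj h
        exact ⟨k, Nat.lt_succ_self k, he.integrity _ _ _ _ hev hs⟩
      · exact of_mem h

theorem mem_sent_of_mem_rcv_succ (hs : s ∉ B) (h : (s, m) ∈ (σ (k + 1) i).rcv) :
    m ∈ (σ k s).sent := by
  obtain ⟨l, hl, hsent⟩ := he.exists_lt_mem_sent_of_mem_rcv hs h
  exact (extends_state (Nat.le_of_lt_succ hl) s).sent hsent

theorem mem_sent_of_mem_rcv (hs : s ∉ B) (h : (s, m) ∈ (σ k i).rcv) : m ∈ (σ k s).sent :=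
  he.mem_sent_of_mem_rcv_succ hs ((extends_state (Nat.le_succ k) i).rcv h)

theorem eventually_mem_rcv (hs : s ∉ B) (hi : i ∉ B) (h : m ∈ (σ k s).sent) :
    ∀ᶠ l in atTop, (s, m) ∈ (σ l i).rcv := by
  obtain ⟨k', hk'⟩ := he.reliability k s i m hs hi h
  filter_upwards [eventually_ge_atTop (k' + 1)] with l hl
  refine (extends_state hl i).rcv ?_
  rw [state_succ_of_event _ x ev hk']
  exact rcv_receive.superset (Set.mem_insert _ _)

theorem eventually_forall_mem_rcv {Q : Finset (Fin n)} (hi : i ∉ B)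
    (h : ∀ s ∈ Q, s ∉ B ∧ ∃ k, m ∈ (σ k s).sent) :
    ∀ᶠ l in atTop, ∀ s ∈ Q, (s, m) ∈ (σ l i).rcv := by
  refine (eventually_all_finset _).2 fun s hs => ?_
  obtain ⟨hsB, k, hk⟩ := h s hs
  exact he.eventually_mem_rcv hsB hi hk

variable (hB : B.card ≤ f)
include hB

theorem eventually_quorum_rcv (hi : i ∉ B) (h : ∀ s ∉ B, ∃ k, m ∈ (σ k s).sent) :
    ∀ᶠ l in atTop, ∃ Q : Finset (Fin n), n - f ≤ Q.card ∧ ∀ s ∈ Q, (s, m) ∈ (σ l i).rcv := by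
  have hcard : n - f ≤ Bᶜ.card := sub_le_card_of_forall_mem hB fun s hs => Finset.mem_compl.2 hs
  filter_upwards [he.eventually_forall_mem_rcv (Q := Bᶜ) hi fun s hs =>
    ⟨Finset.mem_compl.1 hs, h s (Finset.mem_compl.1 hs)⟩] with l hl
  exact ⟨Bᶜ, hcard, hl⟩

theorem exists_sub_le_echoes_of_ready (hi : i ∉ B) (h : Msg.ready o it ∈ (σ k i).sent) :
    ∃ l ≤ k, ∃ j ∉ B, n - f ≤ (σ l j).echoes o it := by
  induction k using Nat.strong_induction_on generalizing i with
  | _ k ih =>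
  rcases (broadcastInv_state k i).quorum_of_ready o it h with hechoes | hreadies
  · exact ⟨k, le_rfl, i, hi, hechoes⟩
  · obtain ⟨Q, hQ, hrcv⟩ := le_readies_iff.1 hreadies
    obtain ⟨s, hs, hsB⟩ := exists_mem_notMem_of_card_le hB hQ
    cases k with
    | zero => exact absurd (hrcv s hs) (Set.notMem_empty _)
    | succ k =>
      obtain ⟨l, hl, hl'⟩ :=
        ih k (Nat.lt_succ_self k) hsB (he.mem_sent_of_mem_rcv_succ hsB (hrcv s hs))
      exact ⟨l, hl.trans (Nat.le_succ k), hl'⟩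

theorem exists_ready_of_delivered_succ (h : (σ (k + 1) i).Delivered f o it) :
    ∃ s ∉ B, Msg.ready o it ∈ (σ k s).sent := by
  obtain ⟨Q, hQ, hrcv⟩ := le_readies_iff.1 h
  obtain ⟨s, hs, hsB⟩ := exists_mem_notMem_of_card_le hB (show f < Q.card by omega)
  exact ⟨s, hsB, he.mem_sent_of_mem_rcv_succ hsB (hrcv s hs)⟩

theorem exists_ready_of_delivered (h : (σ k i).Delivered f o it) :
    ∃ s ∉ B, Msg.ready o it ∈ (σ k s).sent :=
  he.exists_ready_of_delivered_succ hB (h.mono (extends_state (Nat.le_succ k) i).rcv)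

variable (hn : 3 * f < n)
include hn

theorem ready_agreement (hi : i ∉ B) (hj : j ∉ B) (hkey : it.key = it'.key)
    (h : Msg.ready o it ∈ (σ k i).sent) (h' : Msg.ready o it' ∈ (σ l j).sent) : it = it' := by
  obtain ⟨k₁, -, i₁, -, hechoes⟩ := he.exists_sub_le_echoes_of_ready hB hi h
  obtain ⟨k₂, -, i₂, -, hechoes'⟩ := he.exists_sub_le_echoes_of_ready hB hj h'
  obtain ⟨Q, hQ, hrcv⟩ := le_echoes_iff.1 hechoes
  obtain ⟨Q', hQ', hrcv'⟩ := le_echoes_iff.1 hechoes'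
  have hcard : f < (Q ∩ Q').card := by
    have := add_card_le_card_inter_add Q Q'
    omega
  obtain ⟨s, hs, hsB⟩ := exists_mem_notMem_of_card_le hB hcard
  rw [Finset.mem_inter] at hs
  exact (broadcastInv_state _ s).echo_unique o it it' hkey
    ((extends_state (le_max_left k₁ k₂) s).sent (he.mem_sent_of_mem_rcv hsB (hrcv s hs.1)))
    ((extends_state (le_max_right k₁ k₂) s).sent (he.mem_sent_of_mem_rcv hsB (hrcv' s hs.2)))

theorem init_of_ready (hi : i ∉ B) (ho : o ∉ B) (h : Msg.ready o it ∈ (σ k i).sent) :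
    Msg.init it ∈ (σ k o).sent := by
  obtain ⟨l, hl, j, -, hechoes⟩ := he.exists_sub_le_echoes_of_ready hB hi h
  obtain ⟨Q, hQ, hrcv⟩ := le_echoes_iff.1 hechoes
  obtain ⟨s, hs, hsB⟩ := exists_mem_notMem_of_card_le hB (show f < Q.card by omega)
  have hecho := he.mem_sent_of_mem_rcv hsB (hrcv s hs)
  exact (extends_state hl o).sent
    (he.mem_sent_of_mem_rcv ho ((broadcastInv_state l s).init_of_echo o it hecho))

theorem delivered_agreement (hkey : it.key = it'.key) (h : (σ k i).Delivered f o it)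
    (h' : (σ l j).Delivered f o it') : it = it' := by
  obtain ⟨s, hs, hready⟩ := he.exists_ready_of_delivered hB h
  obtain ⟨s', hs', hready'⟩ := he.exists_ready_of_delivered hB h'
  exact he.ready_agreement hB hn hs hs' hkey hready hready'

theorem init_of_delivered_succ (ho : o ∉ B) (h : (σ (k + 1) i).Delivered f o it) :
    Msg.init it ∈ (σ k o).sent := by
  obtain ⟨s, hs, hready⟩ := he.exists_ready_of_delivered_succ hB h
  exact he.init_of_ready hB hn hs ho hready

theorem init_of_delivered (ho : o ∉ B) (h : (σ k i).Delivered f o it) :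
    Msg.init it ∈ (σ k o).sent :=
  he.init_of_delivered_succ hB hn ho (h.mono (extends_state (Nat.le_succ k) i).rcv)

theorem eventually_delivered_of_ready (h : ∀ s ∉ B, ∃ k, Msg.ready o it ∈ (σ k s).sent)
    (hi : i ∉ B) : ∀ᶠ l in atTop, (σ l i).Delivered f o it := by
  filter_upwards [he.eventually_quorum_rcv hB hi h] with l hl
  exact (show 2 * f + 1 ≤ n - f by omega).trans (le_readies_iff.2 hl)

theorem eventually_delivered_of_delivered (h : (σ k j).Delivered f o it) (hi : i ∉ B) :
    ∀ᶠ l in atTop, (σ l i).Delivered f o it := by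
  refine he.eventually_delivered_of_ready hB hn (fun s hs => ?_) hi
  obtain ⟨Q, hQ, hrcv⟩ := le_readies_iff.1 h
  have hcard : f + 1 ≤ (Q \ B).card := by
    have := Finset.le_card_sdiff B Q
    omega
  obtain ⟨l, hl⟩ := (he.eventually_forall_mem_rcv (Q := Q \ B) hs fun s' hs' =>
    have ⟨hs'Q, hs'B⟩ := Finset.mem_sdiff.1 hs'
    ⟨hs'B, k, he.mem_sent_of_mem_rcv hs'B (hrcv s' hs'Q)⟩).exists
  obtain ⟨it', hkey, hready⟩ :=
    (broadcastInv_state l s).exists_ready_of_readies o it (le_readies_iff.2 ⟨_, hcard, hl⟩)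
  obtain ⟨s', hs', hready'⟩ := he.exists_ready_of_delivered hB h
  obtain rfl := he.ready_agreement hB hn hs hs' hkey hready hready'
  exact ⟨l, hready⟩

theorem eventually_delivered_of_init (ho : o ∉ B) (h : Msg.init it ∈ (σ k o).sent) (hi : i ∉ B) :
    ∀ᶠ l in atTop, (σ l i).Delivered f o it := by
  have hecho (s) (hs : s ∉ B) : ∃ l, Msg.echo o it ∈ (σ l s).sent := by
    obtain ⟨l, hl⟩ := (he.eventually_mem_rcv ho hs h).exists
    obtain ⟨it', hkey, hit'⟩ := (broadcastInv_state l s).exists_echo o it hl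
    obtain rfl := init_mem_sent_unique hkey
      (he.mem_sent_of_mem_rcv ho ((broadcastInv_state l s).init_of_echo o it' hit')) h
    exact ⟨l, hit'⟩
  refine he.eventually_delivered_of_ready hB hn (fun s hs => ?_) hi
  obtain ⟨l, hl⟩ := (he.eventually_quorum_rcv hB hs hecho).exists
  have hechoes := le_echoes_iff.2 hl
  obtain ⟨it', hkey, hit'⟩ :=
    (broadcastInv_state l s).exists_ready_of_echoes o it (by omega) hechoes
  obtain rfl := init_mem_sent_unique hkey (he.init_of_ready hB hn hs ho hit') h
  exact ⟨l, hit'⟩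

/-! ### Progress through the rounds -/

theorem exists_report_of_forall_le_round (hround : ∀ o ∉ B, ∃ k, t ≤ (σ k o).round) (hi : i ∉ B) :
    ∃ k A, Msg.init (.report t A) ∈ (σ k i).sent := by
  let p (st : LocalState n d) : Prop := ∀ o ∉ B, ∃ v, st.Delivered f o (.value t v)
  have hp : ∃ k, p (σ k i) := by
    refine Eventually.exists (f := atTop) (eventually_all.2 fun o => ?_)
    rw [eventually_imp_distrib_left]
    intro ho
    obtain ⟨k, hk⟩ := hround o ho
    exact (he.eventually_delivered_of_init hB hn ho
      (((sentInv_state k o).value_iff t _).2 ⟨hk, rfl⟩) hi).mono fun l hl => ⟨_, hl⟩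
  obtain ⟨k, s, m, hst, hsucc, hrelayed⟩ := exists_receive_of_exists_state
    (p := p) (fun _ _ hrcv h o ho => (h o ho).imp fun _ hv => hv.mono hrcv)
    (fun h => (h i hi).elim fun _ => not_delivered_of_rcv_eq_empty rfl) hp
  obtain ⟨v, hv⟩ := hsucc i hi
  have hle : t ≤ (σ k i).round :=
    (((sentInv_state k i).value_iff t v).1 (he.init_of_delivered_succ hB hn hi hv)).1
  rcases hle.lt_or_eq with hlt | rfl
  · exact ⟨k, (sentInv_state k i).exists_report t hlt⟩
  · refine ⟨k + 1, ?_⟩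
    rw [hst, ← round_relayed (f := f) (s := s) (m := m)]
    refine exists_report_mem_sent_progress ?_
    rw [round_relayed]
    exact sub_le_card_of_forall_mem hB fun o ho => mem_dom_values.2 (hrelayed o ho)

theorem eventually_mem_witnesses {A : Finset (Fin n)} (hj : j ∉ B)
    (h : Msg.init (.report t A) ∈ (σ k j).sent) (hi : i ∉ B) :
    ∀ᶠ l in atTop, j ∈ (σ l i).witnesses f t := by
  obtain ⟨hcard, hA⟩ := (sentInv_state k j).report_valid t A h
  have hvalues : ∀ᶠ l in atTop, ∀ o ∈ A, o ∈ ((σ l i).values f t).dom := by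
    refine (eventually_all_finset _).2 fun o ho => ?_
    obtain ⟨v, hv⟩ := hA o ho
    filter_upwards [he.eventually_delivered_of_delivered hB hn hv hi] with l hl
    exact mem_dom_values.2 ⟨v, hl⟩
  filter_upwards [he.eventually_delivered_of_init hB hn hj h hi, hvalues] with l hreport hsub
  exact mem_witnesses.2 ⟨A, hreport, hcard, hsub⟩

theorem exists_le_round_succ (hround : ∀ o ∉ B, ∃ k, t ≤ (σ k o).round) (hi : i ∉ B) :
    ∃ k, t + 1 ≤ (σ k i).round := by
  let p (st : LocalState n d) : Prop := ∀ j ∉ B, j ∈ st.witnesses f t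
  have hp : ∃ k, p (σ k i) := by
    refine Eventually.exists (f := atTop) (eventually_all.2 fun j => ?_)
    rw [eventually_imp_distrib_left]
    intro hj
    obtain ⟨k, A, hA⟩ := he.exists_report_of_forall_le_round hB hn hround hj
    exact he.eventually_mem_witnesses hB hn hj hA hi
  obtain ⟨k, s, m, hst, hsucc, hrelayed⟩ := exists_receive_of_exists_state
    (p := p) (fun _ _ hrcv h j hj => witnesses_mono hrcv (h j hj))
    (fun h => (mem_witnesses.1 (h i hi)).elim fun _ hA => not_delivered_of_rcv_eq_empty rfl hA.1) hp
  obtain ⟨A, hA, -⟩ := mem_witnesses.1 (hsucc i hi)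
  have hsent := he.init_of_delivered_succ hB hn hi hA
  rcases ((sentInv_state k i).report_le t A hsent).lt_or_eq with hlt | rfl
  · exact ⟨k, hlt⟩
  · refine ⟨k + 1, ?_⟩
    rw [hst, ← round_relayed (f := f) (s := s) (m := m)]
    refine (round_progress_of_reported ⟨A, ?_⟩ ?_).ge
    · rw [round_relayed]
      exact extends_relayed.sent hsent
    · rw [round_relayed]
      exact sub_le_card_of_forall_mem hB hrelayed

theorem exists_le_round (t : ℕ) (hi : i ∉ B) : ∃ k, t ≤ (σ k i).round := by
  induction t generalizing i with
  | zero => exact ⟨0, Nat.zero_le _⟩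
  | succ t ih => exact he.exists_le_round_succ hB hn (fun o ho => ih ho) hi

end IsExecution

end RoundProtocol

end Protocol

/-! ### Trajectories -/

/-- What the correct agents do after reliable broadcast is abstracted away: `y i t` is the vector of
agent `i` at the beginning of round `t`, and `V i t` the multiset whose safe area it uses in that
round. -/
structure IsRoundTrace {n d : ℕ} (f : ℕ) (R : Rule d) (B : Finset (Fin n)) (x : Fin n → Vec d)
    (y : Fin n → ℕ → Vec d) (V : Fin n → ℕ → Coll n d) : Prop where
  succ : ∀ i ∉ B, ∀ t, y i (t + 1) = R.point t (safeArea f (V i t))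
  eq_of_correct : ∀ t, 1 ≤ t → ∀ i ∉ B, ∀ o ∉ B, ∀ v, V i t o = some v → v = y o t
  card_common : ∀ t, 1 ≤ t → ∀ i ∉ B, ∀ j ∉ B, n - f ≤ ((V i t).common (V j t)).card
  card_dom_zero : ∀ i ∉ B, n - f ≤ (V i 0).dom.card
  zero_agreement : ∀ i ∉ B, ∀ j ∉ B, ∀ o u u', V i 0 o = some u → V j 0 o = some u' → u = u'
  zero_eq_point : ∀ i ∉ B, ∀ o u, V i 0 o = some u → ∃ X : Coll n d, n - f ≤ X.dom.card ∧
    (∀ o ∉ B, ∀ v, X o = some v → v = x o) ∧ u = R.point 0 (safeArea f X)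

namespace Protocol

open LocalState

section Trajectory

variable {n d : ℕ} (f : ℕ) (R : Rule d) (x : Fin n → Vec d) (ev : Schedule n (Msg n d))
  (i : Fin n) (t : ℕ)

/-- The first step at which agent `i` has reached round `t`; it is `0` if `i` never does. -/
def reachTime : ℕ := sInf {k | t ≤ ((roundProtocol n d f R).state x ev k i).round}

/-- The vector of agent `i` at the beginning of round `t`. -/
def trajectory : Vec d :=
  ((roundProtocol n d f R).state x ev (reachTime f R x ev i t) i).val t

/-- The multiset whose safe area agent `i` uses in round `t`. -/
def usedColl : Coll n d :=
  ((roundProtocol n d f R).state x ev (reachTime f R x ev i (t + 1)) i).coll t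

end Trajectory

variable {n d f : ℕ} {R : Rule d} {B : Finset (Fin n)} {x : Fin n → Vec d}
  {ev : Schedule n (Msg n d)} {k l t : ℕ} {i j o : Fin n} {v u u' : Vec d} {V W : Coll n d}

local notation "σ" => Protocol.state (roundProtocol n d f R) x ev

theorem le_round_reachTime (h : t ≤ (σ k i).round) : t ≤ (σ (reachTime f R x ev i t) i).round :=
  Nat.sInf_mem (s := {k | t ≤ (σ k i).round}) ⟨k, h⟩

theorem reachTime_le (h : t ≤ (σ k i).round) : reachTime f R x ev i t ≤ k := Nat.sInf_le h

theorem val_eq_trajectory (h : t ≤ (σ k i).round) : (σ k i).val t = trajectory f R x ev i t :=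
  (extends_state (reachTime_le h) i).val t (le_round_reachTime h)

theorem coll_eq_usedColl (h : t < (σ k i).round) : (σ k i).coll t = usedColl f R x ev i t :=
  (extends_state (reachTime_le h) i).coll t (le_round_reachTime h)

theorem est_eq_diam_usedColl (h : 0 < (σ k i).round) :
    (σ k i).est = (usedColl f R x ev i 0).diam := by
  rw [(historyInv_state k i).est_eq h, coll_eq_usedColl h]

theorem trajectory_zero : trajectory f R x ev i 0 = x i :=
  (val_eq_trajectory (k := 0) (Nat.zero_le _)).symm

variable (f R x ev i) in
/-- The round whose vector agent `i` decides. -/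
def decisionRound : ℕ := 1 + R.rounds (usedColl f R x ev i 0).diam

theorem decision_eq (k : ℕ) (i : Fin n) : (roundProtocol n d f R).decision (σ k i) =
    if decisionRound f R x ev i ≤ (σ k i).round
    then some (trajectory f R x ev i (decisionRound f R x ev i)) else none := by
  change (if _ then _ else _) = _
  rcases Nat.eq_zero_or_pos (σ k i).round with h0 | h0
  · rw [if_neg (by omega), if_neg (by rw [decisionRound]; omega)]
  · rw [est_eq_diam_usedColl h0]
    exact if_ctx_congr Iff.rfl (fun h => congrArg some (val_eq_trajectory h)) fun _ => rfl

theorem decision_eq_some_iff : (roundProtocol n d f R).decision (σ k i) = some v ↔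
    decisionRound f R x ev i ≤ (σ k i).round ∧
      v = trajectory f R x ev i (decisionRound f R x ev i) := by
  rw [decision_eq, Option.ite_none_right_eq_some, Option.some.injEq, eq_comm (a := v)]

namespace IsExecution

variable (he : (roundProtocol n d f R).IsExecution B x ev) (hB : B.card ≤ f) (hn : 3 * f < n)
include he hB hn

theorem exists_decision_eq (hi : i ∉ B) : ∃ k, (roundProtocol n d f R).decision (σ k i) =
    some (trajectory f R x ev i (decisionRound f R x ev i)) :=
  (he.exists_le_round hB hn _ hi).imp fun _ hk => decision_eq_some_iff.2 ⟨hk, rfl⟩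

theorem eq_trajectory_of_delivered (ho : o ∉ B) (h : (σ k i).Delivered f o (.value t v)) :
    v = trajectory f R x ev o t :=
  have ⟨ht, hv⟩ := ((sentInv_state k o).value_iff t v).1 (he.init_of_delivered hB hn ho h)
  hv.trans (val_eq_trajectory ht)

theorem value_agreement (h : (σ k i).Delivered f o (.value t v))
    (h' : (σ l j).Delivered f o (.value t u)) : v = u :=
  have heq : Item.value t v = .value t u := he.delivered_agreement hB hn rfl h h'
  (Item.value.inj heq).2

theorem report_agreement {A A' : Finset (Fin n)} (h : (σ k i).Delivered f o (.report t A))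
    (h' : (σ l j).Delivered f o (.report t A')) : A = A' :=
  have heq : Item.report t A = .report (d := d) t A' := he.delivered_agreement hB hn rfl h h'
  (Item.report.inj heq).2

theorem card_common_of_isRoundColl (hV : IsRoundColl f (σ k i) t V)
    (hW : IsRoundColl f (σ l j) t W) : n - f ≤ (V.common W).card := by
  obtain ⟨Q, hQ, hreport⟩ := hV.exists_witnesses
  obtain ⟨Q', hQ', hreport'⟩ := hW.exists_witnesses
  obtain ⟨w, hw⟩ : (Q ∩ Q').Nonempty := by
    have := add_card_le_card_inter_add Q Q'
    exact Finset.card_pos.1 (by omega)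
  obtain ⟨A, hA, hcard, hAV⟩ := hreport w (Finset.mem_inter.1 hw).1
  obtain ⟨A', hA', -, hAW⟩ := hreport' w (Finset.mem_inter.1 hw).2
  obtain rfl := he.report_agreement hB hn hA hA'
  refine hcard.trans (Finset.card_le_card fun o ho => Coll.mem_common.2 ?_)
  obtain ⟨v, hv⟩ := Coll.mem_dom.1 (hAV ho)
  obtain ⟨v', hv'⟩ := Coll.mem_dom.1 (hAW ho)
  obtain rfl := he.value_agreement hB hn (hV.delivered o v hv) (hW.delivered o v' hv')
  exact ⟨v, hv, hv'⟩

theorem eq_of_isEstimateColl (hV : IsEstimateColl f R (σ k i) V)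
    (hW : IsEstimateColl f R (σ l j) W) (hu : V o = some u) (hu' : W o = some u') : u = u' := by
  obtain ⟨X, hreport, -, hX, rfl⟩ := hV.exists_report o u hu
  obtain ⟨X', hreport', -, hX', rfl⟩ := hW.exists_report o u' hu'
  have hXX' : X = X' := Coll.ext_of_dom_eq (he.report_agreement hB hn hreport hreport')
    fun o v v' hv hv' => he.value_agreement hB hn (hX o v hv) (hX' o v' hv')
  rw [hXX']

theorem isRoundTrace : IsRoundTrace f R B x (trajectory f R x ev) (usedColl f R x ev) := by
  have reached {i} (hi : i ∉ B) (t) : t ≤ (σ (reachTime f R x ev i t) i).round :=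
    have ⟨_, hk⟩ := he.exists_le_round hB hn t hi
    le_round_reachTime hk
  have isRoundColl {i} (hi : i ∉ B) {t} (ht : 1 ≤ t) :
      IsRoundColl f (σ (reachTime f R x ev i (t + 1)) i) t (usedColl f R x ev i t) :=
    (historyInv_state _ i).coll_pos t (reached hi (t + 1)) ht
  have isEstimateColl {i} (hi : i ∉ B) :
      IsEstimateColl f R (σ (reachTime f R x ev i 1) i) (usedColl f R x ev i 0) :=
    (historyInv_state _ i).coll_zero (reached hi 1)
  refine ⟨fun i hi t => (historyInv_state _ i).val_succ t (reached hi (t + 1)),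
    fun t ht i hi o ho v hv =>
      he.eq_trajectory_of_delivered hB hn ho ((isRoundColl hi ht).delivered o v hv),
    fun t ht i hi j hj =>
      he.card_common_of_isRoundColl hB hn (isRoundColl hi ht) (isRoundColl hj ht),
    fun i hi => (isEstimateColl hi).card_dom,
    fun i hi j hj o u u' => he.eq_of_isEstimateColl hB hn (isEstimateColl hi) (isEstimateColl hj),
    fun i hi o u hu => ?_⟩
  obtain ⟨X, -, hcard, hX, hpoint⟩ := (isEstimateColl hi).exists_report o u hu
  exact ⟨X, hcard, fun o ho v hv =>
    (he.eq_trajectory_of_delivered hB hn ho (hX o v hv)).trans trajectory_zero, hpoint⟩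

end IsExecution

end Protocol

/-! ### Validity -/

/-- The rule selects, in every nonempty compact convex set, a point of that set. -/
def Rule.IsSafe {d : ℕ} (R : Rule d) : Prop :=
  ∀ t S, IsCompact S → Convex ℝ S → S.Nonempty → R.point t S ∈ S

theorem midExtremes_isSafe {d : ℕ} {sel : Set (Vec d) → Vec d × Vec d} (hsel : IsDiamSelector sel)
    (ε : ℝ) : (midExtremes sel ε).IsSafe := fun _ S hcompact hconvex hne =>
  have ⟨ha, hb, _⟩ := hsel S hcompact hne
  hconvex.midpoint_mem ha hb

theorem mul_lt_of_sub_le {n d f k : ℕ} (hn : (d + 2) * f < n) (hk : n - f ≤ k) :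
    (d + 1) * f < k := by
  have : (d + 2) * f = (d + 1) * f + f := by ring
  omega

namespace IsRoundTrace

section Safe

variable {n d f : ℕ} {R : Rule d} {B : Finset (Fin n)} {x : Fin n → Vec d}
  {y : Fin n → ℕ → Vec d} {V : Fin n → ℕ → Coll n d} {s t : ℕ} {i j o : Fin n}
  (h : IsRoundTrace f R B x y V)
include h

theorem safeArea_subset (hB : B.card ≤ f) (ht : 1 ≤ t) (hi : i ∉ B) :
    safeArea f (V i t) ⊆ correctHull B fun o => y o t :=
  safeArea_subset_convexHull hB fun o ho v hv => ⟨o, ho, (h.eq_of_correct t ht i hi o ho v hv).symm⟩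

variable (hn : (d + 2) * f < n)
include hn

theorem safeArea_nonempty (hi : i ∉ B) (t : ℕ) : (safeArea f (V i t)).Nonempty := by
  refine ByzMP.safeArea_nonempty (mul_lt_of_sub_le hn ?_)
  rcases Nat.eq_zero_or_pos t with rfl | ht
  · exact h.card_dom_zero i hi
  · exact (h.card_common t ht i hi i hi).trans (Finset.card_le_card (Coll.common_subset_dom _ _))

theorem safeArea_inter_nonempty (ht : 1 ≤ t) (hi : i ∉ B) (hj : j ∉ B) :
    (safeArea f (V i t) ∩ safeArea f (V j t)).Nonempty :=
  ByzMP.safeArea_inter_nonempty (mul_lt_of_sub_le hn (h.card_common t ht i hi j hj))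

variable (hR : R.IsSafe)
include hR

theorem mem_safeArea (hi : i ∉ B) (t : ℕ) : y i (t + 1) ∈ safeArea f (V i t) := by
  rw [h.succ i hi t]
  exact hR t _ (isCompact_safeArea _) (convex_safeArea _) (h.safeArea_nonempty hn hi t)

theorem one_mem_convexHull (hi : i ∉ B) (hj : j ∉ B) :
    y j 1 ∈ convexHull ℝ ((V i 0).vals (V i 0).dom) := by
  have hcard : (V j 0).dom.card ≤ ((V j 0).dom ∩ (V i 0).dom).card + f := by
    have := add_card_le_card_inter_add (V j 0).dom (V i 0).dom
    have := h.card_dom_zero i hi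
    omega
  have hvals : (V j 0).vals ((V j 0).dom ∩ (V i 0).dom) ⊆ (V i 0).vals (V i 0).dom := by
    rintro v ⟨o, ho, hv⟩
    have hoi := (Finset.mem_inter.1 ho).2
    obtain ⟨v', hv'⟩ := Coll.mem_dom.1 hoi
    exact ⟨o, hoi, h.zero_agreement i hi j hj o v' v hv' hv ▸ hv'⟩
  exact convexHull_mono hvals
    (safeArea_subset_convexHull_vals Finset.inter_subset_left hcard (h.mem_safeArea hn hR hj 0))

theorem correctDiam_one_le_estimate (hi : i ∉ B) :
    correctDiam B (fun j => y j 1) ≤ (V i 0).diam := by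
  rw [Coll.diam, ← convexHull_diam]
  exact correctDiam_le_diam (isBounded_convexHull.2 (Coll.finite_vals _ _).isBounded)
    fun j hj => h.one_mem_convexHull hn hR hi hj

variable (hB : B.card ≤ f)
include hB

theorem zero_mem_correctHull (hi : i ∉ B) {u : Vec d} (hu : V i 0 o = some u) :
    u ∈ correctHull B x := by
  obtain ⟨X, hcard, hX, rfl⟩ := h.zero_eq_point i hi o u hu
  have hsub : safeArea f X ⊆ correctHull B x :=
    safeArea_subset_convexHull hB fun o ho v hv => ⟨o, ho, (hX o ho v hv).symm⟩
  exact hsub (hR 0 _ (isCompact_safeArea _) (convex_safeArea _)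
    (ByzMP.safeArea_nonempty (mul_lt_of_sub_le hn hcard)))

theorem vals_zero_subset_correctHull (hi : i ∉ B) :
    (V i 0).vals (V i 0).dom ⊆ correctHull B x := fun _ ⟨_, _, hu⟩ =>
  h.zero_mem_correctHull hn hR hB hi hu

theorem estimate_le (hi : i ∉ B) : (V i 0).diam ≤ correctDiam B x := by
  rw [← diam_correctHull]
  exact Metric.diam_mono (h.vals_zero_subset_correctHull hn hR hB hi) (isBounded_correctHull B x)

theorem correctHull_antitone (hs : 1 ≤ s) (hst : s ≤ t) :
    correctHull B (fun o => y o t) ⊆ correctHull B fun o => y o s := by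
  induction t, hst using Nat.le_induction with
  | base => exact subset_rfl
  | succ t hst ih =>
    exact (correctHull_subset (convex_convexHull ℝ _) fun i hi =>
      h.safeArea_subset hB (hs.trans hst) hi (h.mem_safeArea hn hR hi t)).trans ih

theorem mem_correctHull_inputs (ht : 1 ≤ t) (hi : i ∉ B) : y i t ∈ correctHull B x := by
  have hone : correctHull B (fun o => y o 1) ⊆ correctHull B x :=
    correctHull_subset (convex_convexHull ℝ _) fun j hj =>
      convexHull_min (h.vals_zero_subset_correctHull hn hR hB hj) (convex_convexHull ℝ _)
        (h.one_mem_convexHull hn hR hj hj)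
  exact hone (h.correctHull_antitone hn hR hB le_rfl ht (mem_correctHull (z := fun o => y o t) hi))

theorem correctDiam_one_le : correctDiam B (fun i => y i 1) ≤ correctDiam B x := by
  rw [← diam_correctHull B x]
  exact correctDiam_le_diam (isBounded_correctHull B x) fun i hi =>
    h.mem_correctHull_inputs hn hR hB le_rfl hi

end Safe

/-! ### Contraction -/

section MidExtremes

variable {n d f : ℕ} {B : Finset (Fin n)} {x : Fin n → Vec d} {y : Fin n → ℕ → Vec d}
  {V : Fin n → ℕ → Coll n d} {sel : Set (Vec d) → Vec d × Vec d} {ε D : ℝ} {s t : ℕ} {i j : Fin n}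
  (h : IsRoundTrace f (midExtremes sel ε) B x y V) (hn : (d + 2) * f < n)
  (hsel : IsDiamSelector sel)
include h hn hsel

theorem realizesDiam_safeArea (hi : i ∉ B) (t : ℕ) :
    RealizesDiam (safeArea f (V i t)) (sel (safeArea f (V i t))).1 (sel (safeArea f (V i t))).2 :=
  hsel _ (isCompact_safeArea _) (h.safeArea_nonempty hn hi t)

variable (hB : B.card ≤ f)
include hB

theorem correctDiam_succ_le (ht : 1 ≤ t) :
    correctDiam B (fun i => y i (t + 1)) ≤ √(7 / 8) * correctDiam B (fun i => y i t) := by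
  rw [← diam_correctHull B fun i => y i t]
  refine correctDiam_le_of_forall_dist_le (by positivity) fun i hi j hj => ?_
  rw [h.succ i hi t, h.succ j hj t]
  exact dist_midpoint_midpoint_le_sqrt_mul_diam (isBounded_correctHull B _)
    (h.safeArea_subset hB ht hi) (h.safeArea_subset hB ht hj)
    (h.realizesDiam_safeArea hn hsel hi t) (h.realizesDiam_safeArea hn hsel hj t)
    (h.safeArea_inter_nonempty hn ht hi hj)

theorem correctDiam_one_add_le (s : ℕ) :
    correctDiam B (fun i => y i (1 + s)) ≤ √(7 / 8) ^ s * correctDiam B (fun i => y i 1) := by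
  induction s with
  | zero => simp
  | succ s ih =>
    calc correctDiam B (fun i => y i (1 + (s + 1)))
        ≤ √(7 / 8) * correctDiam B (fun i => y i (1 + s)) :=
          h.correctDiam_succ_le hn hsel hB (Nat.le_add_right _ _)
      _ ≤ √(7 / 8) * (√(7 / 8) ^ s * correctDiam B (fun i => y i 1)) := by gcongr
      _ = √(7 / 8) ^ (s + 1) * correctDiam B (fun i => y i 1) := by ring

variable (hε : 0 < ε)
include hε

theorem correctDiam_one_add_midRounds_le (hD : correctDiam B (fun i => y i 1) ≤ D) :
    correctDiam B (fun i => y i (1 + midRounds ε D)) ≤ ε :=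
  calc correctDiam B (fun i => y i (1 + midRounds ε D))
      ≤ √(7 / 8) ^ midRounds ε D * correctDiam B (fun i => y i 1) :=
        h.correctDiam_one_add_le hn hsel hB _
    _ ≤ √(7 / 8) ^ midRounds ε D * D := by gcongr
    _ ≤ ε := sqrt_pow_midRounds_mul_le hε

theorem dist_le (hD : correctDiam B (fun i => y i 1) ≤ D) (hs : 1 + midRounds ε D ≤ s)
    (ht : 1 + midRounds ε D ≤ t) (hi : i ∉ B) (hj : j ∉ B) : dist (y i s) (y j t) ≤ ε := by
  have mem_hull {i t} (ht : 1 + midRounds ε D ≤ t) (hi : i ∉ B) :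
      y i t ∈ correctHull B fun o => y o (1 + midRounds ε D) :=
    h.correctHull_antitone hn (midExtremes_isSafe hsel ε) hB (Nat.le_add_right _ _) ht
      (mem_correctHull (z := fun o => y o t) hi)
  calc dist (y i s) (y j t)
      ≤ Metric.diam (correctHull B fun o => y o (1 + midRounds ε D)) :=
        Metric.dist_le_diam_of_mem (isBounded_correctHull B _) (mem_hull hs hi) (mem_hull ht hj)
    _ ≤ ε := by
        rw [diam_correctHull]
        exact h.correctDiam_one_add_midRounds_le hn hsel hB hε hD

theorem correctDiam_le (ht : 1 + midRounds ε (correctDiam B x) ≤ t) :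
    correctDiam B (fun i => y i t) ≤ ε :=
  correctDiam_le_of_forall_dist_le hε.le fun _ hi _ hj =>
    h.dist_le hn hsel hB hε (h.correctDiam_one_le hn (midExtremes_isSafe hsel ε) hB) ht ht hi hj

end MidExtremes

end IsRoundTrace

/-! ### The two algorithms -/

section Algorithms

open Protocol

variable {n d f : ℕ} {B : Finset (Fin n)} {x : Fin n → Vec d} {ev : Schedule n (Msg n d)}
  {sel : Set (Vec d) → Vec d × Vec d} {c : ℕ → Set (Vec d) → Vec d} {ε D : ℝ} {i : Fin n} {k : ℕ}

theorem three_mul_lt (hd : 1 ≤ d) (hn : (d + 2) * f < n) : 3 * f < n :=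
  (Nat.mul_le_mul_right f (by omega)).trans_lt hn

theorem midExtremes_solvesApproxConsensus (hd : 1 ≤ d) (hn : (d + 2) * f < n) (hε : 0 < ε)
    (hsel : IsDiamSelector sel) :
    (roundProtocol n d f (midExtremes sel ε)).SolvesApproxConsensus f ε := by
  intro B hB x ev he
  have hn3 := three_mul_lt hd hn
  have hsafe := midExtremes_isSafe hsel ε
  have h := he.isRoundTrace hB hn3
  refine ⟨fun i hi => ?termination, fun i _ k l v hkl hv => ?irrevocability,
    fun i hi j hj k l v w hv hw => ?agreement, fun i hi k v hv => ?validity⟩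
  case termination => exact (he.exists_decision_eq hB hn3 hi).imp fun _ hk => ⟨_, hk⟩
  case irrevocability =>
    obtain ⟨hround, rfl⟩ := decision_eq_some_iff.1 hv
    exact decision_eq_some_iff.2 ⟨hround.trans (extends_state hkl i).round, rfl⟩
  case agreement =>
    obtain ⟨-, rfl⟩ := decision_eq_some_iff.1 hv
    obtain ⟨-, rfl⟩ := decision_eq_some_iff.1 hw
    rw [← dist_eq_norm]
    rcases le_total (decisionRound f (midExtremes sel ε) x ev i)
      (decisionRound f (midExtremes sel ε) x ev j) with hle | hle
    · exact h.dist_le hn hsel hB hε (h.correctDiam_one_le_estimate hn hsafe hi) le_rfl hle hi hj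
    · exact h.dist_le hn hsel hB hε (h.correctDiam_one_le_estimate hn hsafe hj) hle le_rfl hi hj
  case validity =>
    obtain ⟨-, rfl⟩ := decision_eq_some_iff.1 hv
    exact h.mem_correctHull_inputs hn hsafe hB (Nat.le_add_right _ _) hi

theorem decisionRound_midExtremes_le (hd : 1 ≤ d) (hn : (d + 2) * f < n) (hε : 0 < ε)
    (hsel : IsDiamSelector sel) (hB : B.card ≤ f)
    (he : (roundProtocol n d f (midExtremes sel ε)).IsExecution B x ev) (hi : i ∉ B) :
    decisionRound f (midExtremes sel ε) x ev i ≤ 1 + midRounds ε (correctDiam B x) :=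
  Nat.add_le_add_left (midRounds_mono hε Metric.diam_nonneg
    ((he.isRoundTrace hB (three_mul_lt hd hn)).estimate_le hn (midExtremes_isSafe hsel ε) hB hi)) 1

theorem half_mul_logb_le_round_of_decision_mendesHerlihy (hd : 1 ≤ d) (hε : 0 < ε)
    (hΔ : ε ≤ correctDiam B x) (hD : correctDiam B x ≤ D)
    (h : ((roundProtocol n d f (mendesHerlihy c ε D)).decision
      ((roundProtocol n d f (mendesHerlihy c ε D)).state x ev k i)).isSome) :
    1 / 2 * (d * Real.logb 2 (d * correctDiam B x / ε)) ≤
      ((roundProtocol n d f (mendesHerlihy c ε D)).state x ev k i).round := by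
  obtain ⟨v, hv⟩ := Option.isSome_iff_exists.1 h
  have hround : d * coordRounds d ε D ≤
      ((roundProtocol n d f (mendesHerlihy c ε D)).state x ev k i).round :=
    (Nat.le_add_left _ 1).trans (decision_eq_some_iff.1 hv).1
  exact (half_mul_logb_le_mul_coordRounds hd hε hΔ hD).trans (Nat.cast_le.2 hround)

end Algorithms

end ByzMP

end

theorem mainTheorem3 (n d f : ℕ) (hd : 1 ≤ d) (hn : (d + 2) * f < n) (ε : ℝ) (hε : 0 < ε)
    (sel : Set (Vec d) → Vec d × Vec d) (hsel : IsDiamSelector sel) :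
    -- the variant with the midpoint of a diameter-realizing pair solves approximate consensus
    (roundProtocol n d f (midExtremes sel ε)).SolvesApproxConsensus f ε ∧
    -- in each of its executions there are vectors `y i t` (agent `i`, beginning of round `t`) and
    -- multisets `V i t` (used by `i` in round `t`) with the following properties
    (∀ B : Finset (Fin n), B.card ≤ f → ∀ (x : Fin n → Vec d) (ev : Schedule n (Msg n d)),
      (roundProtocol n d f (midExtremes sel ε)).IsExecution B x ev →
      ∃ (y : Fin n → ℕ → Vec d) (V : Fin n → ℕ → Coll n d),
        -- correct agents reach all rounds, with vectors `y` and multisets `V`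
        (∀ i ∉ B, ∀ t, ∃ k,
          t ≤ ((roundProtocol n d f (midExtremes sel ε)).state x ev k i).round) ∧
        (∀ i ∉ B, ∀ t k,
          t ≤ ((roundProtocol n d f (midExtremes sel ε)).state x ev k i).round →
          ((roundProtocol n d f (midExtremes sel ε)).state x ev k i).val t = y i t) ∧
        (∀ i ∉ B, ∀ t k,
          t < ((roundProtocol n d f (midExtremes sel ε)).state x ev k i).round →
          ((roundProtocol n d f (midExtremes sel ε)).state x ev k i).coll t = V i t) ∧
        (∀ i ∉ B, y i 0 = x i) ∧
        -- round structure, safe areas and update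
        (∀ t, 1 ≤ t → ∀ i ∉ B,
          (∀ o ∉ B, ∀ v, V i t o = some v → v = y o t) ∧
          (∀ j ∉ B, n - f ≤ ((V i t).common (V j t)).card) ∧
          safeArea f (V i t) ⊆ convexHull ℝ ((fun o => y o t) '' {o | o ∉ B}) ∧
          (∀ j ∉ B, (safeArea f (V i t) ∩ safeArea f (V j t)).Nonempty) ∧
          ∃ a ∈ safeArea f (V i t), ∃ b ∈ safeArea f (V i t),
            dist a b = Metric.diam (safeArea f (V i t)) ∧ y i (t + 1) = midpoint ℝ a b) ∧
        -- the initial round does not increase the diameter of the vectors of correct agents,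
        -- every further round contracts it by `√(7/8)`
        correctDiam B (fun i => y i 1) ≤ correctDiam B x ∧
        (∀ t, 1 ≤ t → correctDiam B (fun i => y i (t + 1)) ≤
          Real.sqrt (7 / 8) * correctDiam B (fun i => y i t)) ∧
        -- hence it is at most `ε` after the initial round and `⌈log_{√(8/7)} (Δ/ε)⌉` further ones
        (∀ t, 1 + ⌈Real.logb (Real.sqrt (8 / 7)) (correctDiam B x / ε)⌉₊ ≤ t →
          correctDiam B (fun i => y i t) ≤ ε) ∧
        -- and all correct agents decide within that number of rounds
        (∀ i ∉ B, ∃ r, 1 ≤ r ∧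
          r ≤ 1 + ⌈Real.logb (Real.sqrt (8 / 7)) (correctDiam B x / ε)⌉₊ ∧
          ∀ k, r ≤ ((roundProtocol n d f (midExtremes sel ε)).state x ev k i).round →
            (roundProtocol n d f (midExtremes sel ε)).decision
              ((roundProtocol n d f (midExtremes sel ε)).state x ev k i) = some (y i r))) ∧
    -- the coordinate-wise Mendes–Herlihy algorithm, for any valid bound `D` on the initial
    -- diameter, needs `Ω(d log (dΔ/ε))` rounds until any correct agent decides
    (∀ (c : ℕ → Set (Vec d) → Vec d), IsCoordSelector c → ∀ D : ℝ,
      ∀ B : Finset (Fin n), B.card ≤ f → ∀ (x : Fin n → Vec d) (ev : Schedule n (Msg n d)),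
      correctDiam B x ≤ D → ε ≤ correctDiam B x →
      (roundProtocol n d f (mendesHerlihy c ε D)).IsExecution B x ev →
      ∀ i ∉ B,
        (∃ k, ((roundProtocol n d f (mendesHerlihy c ε D)).decision
          ((roundProtocol n d f (mendesHerlihy c ε D)).state x ev k i)).isSome) ∧
        ∀ k, ((roundProtocol n d f (mendesHerlihy c ε D)).decision
            ((roundProtocol n d f (mendesHerlihy c ε D)).state x ev k i)).isSome →
          1 / 2 * (d * Real.logb 2 (d * correctDiam B x / ε)) ≤
            ((roundProtocol n d f (mendesHerlihy c ε D)).state x ev k i).round) := by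
  have hn3 := three_mul_lt hd hn
  refine ⟨midExtremes_solvesApproxConsensus hd hn hε hsel, fun B hB x ev he => ?contraction,
    fun c _ D B hB x ev hD hΔ he i hi => ⟨?decision, fun _ =>
      half_mul_logb_le_round_of_decision_mendesHerlihy hd hε hΔ hD⟩⟩
  case contraction =>
    have h := he.isRoundTrace hB hn3
    refine ⟨Protocol.trajectory f _ x ev, Protocol.usedColl f _ x ev,
      fun i hi t => he.exists_le_round hB hn3 t hi, fun _ _ _ _ => Protocol.val_eq_trajectory,
      fun _ _ _ _ => Protocol.coll_eq_usedColl, fun _ _ => Protocol.trajectory_zero,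
      fun t ht i hi => ?_,
      h.correctDiam_one_le hn (midExtremes_isSafe hsel ε) hB,
      fun t ht => h.correctDiam_succ_le hn hsel hB ht,
      fun t ht => h.correctDiam_le hn hsel hB hε ht,
      fun i hi => ⟨Protocol.decisionRound f _ x ev i, Nat.le_add_right _ _,
        decisionRound_midExtremes_le hd hn hε hsel hB he hi,
        fun k hk => Protocol.decision_eq_some_iff.2 ⟨hk, rfl⟩⟩⟩
    obtain ⟨ha, hb, hab⟩ := h.realizesDiam_safeArea hn hsel hi t
    exact ⟨h.eq_of_correct t ht i hi, h.card_common t ht i hi, h.safeArea_subset hB ht hi,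
      fun j hj => h.safeArea_inter_nonempty hn ht hi hj, _, ha, _, hb, hab, h.succ i hi t⟩
  case decision =>
    obtain ⟨k, hk⟩ := he.exists_decision_eq hB hn3 hi
    exact ⟨k, Option.isSome_of_eq_some hk⟩
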